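/- **Setting.** Let $n,r,q$ be natural numbers. Matrix spaces carry the trace inner product $\langle\cdot,\cdot\rangle$ and the Frobenius norm $\|\cdot\|_F$; pairs of matrices carry the norm $(\|X\|_F^2+\|Y\|_F^2)^{1/2}$; $\|X\|$ denotes the spectral norm of a matrix. Let $\Psi,\Phi:\mathbb R^{n\times r}\to\mathbb R\cup\{+\infty\}$ be proper, closed (lower semicontinuous) and bounded from below, let $b\in\mathbb R^q$, $\lambda\ge 0$, and let $\mathcal A:\mathbb R^{n\times n}\to\mathbb R^q$ be linear with $\mathcal A\mathcal A^*=\mathcal I_q$. Put $$\mathcal F_\lambda(X,Y)=\Psi(X)+\Phi(Y)+\tfrac12\|\mathcal A(XY^\top)-b\|^2+\tfrac\lambda2\|X-Y\|_F^2 ,$$ and assume that $\mathcal F_\lambda$ is level-bounded (all its sublevel sets $\{\mathcal F_\lambda\le t\}$, $t\in\mathbb R$, are bounded). **Subdifferential and KL exponent.** For a proper closed function $h$ on a Euclidean space and $x$ with $h(x)<\infty$, the Fréchet subdifferential $\widehat\partial h(x)$ is the set of all $D$ with $\liminf_{y\to x,\,y\ne x}\frac{h(y)-h(x)-\langle D,y-x\rangle}{\|y-x\|}\ge0$,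 and the limiting subdifferential $\partial h(x)$ is the set of limits of sequences $D^k\in\widehat\partial h(x^k)$ with $x^k\to x$ and $h(x^k)\to h(x)$; $\partial h(x)=\emptyset$ if $h(x)=\infty$. The function $h$ is a KL function with exponent $\theta\in[0,1)$ if for every $x$ with $\partial h(x)\neq\emptyset$ there are $\tilde a>0$, $\nu\in(0,+\infty]$ and a neighborhood $\mathcal V$ of $x$ such that, with $\varphi(t)=\tilde a\,t^{1-\theta}$, $$\varphi'\big(h(y)-h(x)\big)\,\operatorname{dist}\big(0,\partial h(y)\big)\ge 1\qquad\text{for all } y\in\mathcal V\text{ with } h(x)<h(y)<h(x)+\nu$$ (where $\operatorname{dist}(0,\emptyset)=+\infty$). **Algorithm (A-NAUM).** Let $\alpha,\beta\ne0$ be real with $\frac1\alpha+\frac1\beta=1$, let $\rho=\|\mathcal I-\frac\beta{\alpha+\beta}\mathcal A^*\mathcal A\|^2$, let $\gamma\ge0$ satisfy $(\alpha+\gamma)\mathcal I+\beta\mathcal A^*\mathcal A\succeq0$, and let $\mu^{\min}>0$, $0<\sigma^{\min}<\sigma^{\max}<\infty$, $\tau>1$, $c>0$, $0<p_{\min}<1$.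 Put $\mathcal H_\alpha(X,Y,Z)=\frac\alpha2\|XY^\top-Z\|_F^2$. Start from $(X^0,Y^0)$ with $\mathcal F_\lambda(X^0,Y^0)<\infty$ and $\mathcal R_0=\mathcal F_\lambda(X^0,Y^0)$. For $k=0,1,2,\dots$: 1. Set $Z^k=(\mathcal I-\frac\beta{\alpha+\beta}\mathcal A^*\mathcal A)(X^k(Y^k)^\top)+\frac\beta{\alpha+\beta}\mathcal A^*(b)$. 2. Choose $\mu_k^0\ge\mu^{\min}$ and $\sigma_k^0\in[\sigma^{\min},\sigma^{\max}]$; set $\mu_k=\mu_k^0$, $\sigma_k=\sigma_k^0$, $\mu_k^{\max}=(\alpha+2\gamma\rho)\|Y^k\|^2+c$. - (2a) Set $\mu_k\leftarrow\min\{\mu_k,\mu_k^{\max}\}$ and compute $U$ by one of the following: *proximal*, $U\in\arg\min_X\Psi(X)+\mathcal H_\alpha(X,Y^k,Z^k)+\frac\lambda2\|X-Y^k\|_F^2+\frac{\mu_k}2\|X-X^k\|_F^2$; *prox-linear*, the same with $\mathcal H_\alpha(X,Y^k,Z^k)$ replaced by $\langle\nabla_X\mathcal H_\alpha(X^k,Y^k,Z^k),X-X^k\rangle$;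 *hierarchical*, available if $\Psi(X)=\sum_{i=1}^r\psi_i(x_i)$ with $x_i$ the columns of $X$ and every $\psi_i$ proper, closed and bounded from below: for $i=1,\dots,r$, $u_i\in\arg\min_{x}\psi_i(x)+\mathcal H_\alpha([u_1,\dots,u_{i-1},x,x^k_{i+1},\dots,x^k_r],Y^k,Z^k)+\frac\lambda2\|x-y_i^k\|^2+\frac{\mu_k}2\|x-x_i^k\|^2$. - (2b) Compute $V$ by one of the following: *proximal*, $V\in\arg\min_Y\Phi(Y)+\mathcal H_\alpha(U,Y,Z^k)+\frac\lambda2\|U-Y\|_F^2+\frac{\sigma_k}2\|Y-Y^k\|_F^2$; *prox-linear*, the same with $\mathcal H_\alpha(U,Y,Z^k)$ replaced by $\langle\nabla_Y\mathcal H_\alpha(U,Y^k,Z^k),Y-Y^k\rangle$; *hierarchical*, available if $\Phi(Y)=\sum_{i=1}^r\phi_i(y_i)$ with every $\phi_i$ proper, closed and bounded from below: for $i=1,\dots,r$, $v_i\in\arg\min_{y}\phi_i(y)+\mathcal H_\alpha(U,[v_1,\dots,v_{i-1},y,y^k_{i+1},\dots,y^k_r],Z^k)+\frac\lambda2\|u_i-y\|^2+\frac{\sigma_k}2\|y-y_i^k\|^2$.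 - (2c) If $\mathcal F_\lambda(U,V)-\mathcal R_k\le-\frac c2(\|U-X^k\|_F^2+\|V-Y^k\|_F^2)$, go to 3. - (2d) If $\mu_k=\mu_k^{\max}$, set $\sigma_k\leftarrow\min\{\tau\sigma_k,\,(\alpha+2\gamma\rho)\|U\|^2+c\}$ and go to (2b); otherwise set $\mu_k\leftarrow\tau\mu_k$, $\sigma_k\leftarrow\tau\sigma_k$ and go to (2a). 3. Set $(X^{k+1},Y^{k+1})=(U,V)$, choose $p_{k+1}\in[p_{\min},1]$, and set $\mathcal R_{k+1}=(1-p_{k+1})\mathcal R_k+p_{k+1}\mathcal F_\lambda(X^{k+1},Y^{k+1})$. **Theorem 5.3.** Suppose that $\mathcal F_\lambda$ is a KL function with exponent $\theta\in[0,1)$, and let $\{(X^k,Y^k)\}_{k\ge0}$, $\{\mathcal R_k\}_{k\ge0}$ be infinite sequences generated by A-NAUM. Then all values $\mathcal F_\lambda(X^k,Y^k)$ are finite, $\{\mathcal R_k\}$ converges to some $\zeta\in\mathbb R$, $\mathcal F_\lambda(X^k,Y^k)\to\zeta$, and: - (i) if $\theta=0$, there exist $c_1>0$ and $\eta_1\in(0,1)$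 such that $\zeta-c_1\eta_1^k\le\mathcal F_\lambda(X^k,Y^k)\le\zeta$ for all sufficiently large $k$; - (ii) if $\theta\in(0,\frac12]$, there exist $c_2>0$ and $\eta_2\in(0,1)$ such that $|\mathcal F_\lambda(X^k,Y^k)-\zeta|\le c_2\eta_2^k$ for all sufficiently large $k$; - (iii) if $\theta\in(\frac12,1)$, there exists $c_3>0$ such that $|\mathcal F_\lambda(X^k,Y^k)-\zeta|\le c_3k^{-\frac1{2\theta-1}}$ for all sufficiently large $k$. -/

import Mathlib

open Filter Topology

noncomputable section

/-! ## Matrices, with the Frobenius inner product and norm -/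

/-- Real `m × n` matrices. As a Euclidean space indexed by the entries, it carries the trace
inner product `⟪X, Y⟫ = ∑ᵢⱼ Xᵢⱼ Yᵢⱼ` and the Frobenius norm. -/
abbrev Mat (m n : ℕ) : Type := EuclideanSpace ℝ (Fin m × Fin n)

/-- Pairs of matrices, with norm `√(‖X‖_F² + ‖Y‖_F²)` and the corresponding inner product. -/
abbrev MatPair (n r : ℕ) : Type := WithLp 2 (Mat n r × Mat n r)

/-- The product `X Yᵀ`. -/
def mulT {n r : ℕ} (X Y : Mat n r) : Mat n n :=
  WithLp.toLp 2 fun p => ∑ j, X (p.1, j) * Y (p.2, j)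

/-- The `j`-th column of `X`. -/
def col {n r : ℕ} (X : Mat n r) (j : Fin r) : EuclideanSpace ℝ (Fin n) :=
  WithLp.toLp 2 fun i => X (i, j)

/-- The spectral norm (largest singular value), as the operator norm between Euclidean spaces. -/
def specNorm {n r : ℕ} (X : Mat n r) : ℝ :=
  ‖(Matrix.toEuclideanLin (Matrix.of fun i j => X (i, j))).toContinuousLinearMap‖

/-- The matrix `[u₁, …, uᵢ₋₁, x, xᵢ₊₁, …, xᵣ]`, whose columns before the `i`-th come from `U`,
and those after the `i`-th from `X`. -/
def mixCols {n r : ℕ} (U : Mat n r) (i : Fin r) (x : EuclideanSpace ℝ (Fin n)) (X : Mat n r) :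
    Mat n r :=
  WithLp.toLp 2 fun p => if p.2 < i then U p else if p.2 = i then x p.1 else X p

/-! ## Extended-real-valued functions, subdifferentials, the KL property -/

/-- `h` is proper: never `-∞`, and somewhere finite. -/
def ProperFun {E : Type*} (h : E → EReal) : Prop :=
  (∀ x, h x ≠ ⊥) ∧ ∃ x, h x ≠ ⊤

/-- `h` is bounded from below by a real constant. -/
def BddBelowFun {E : Type*} (h : E → EReal) : Prop :=
  ∃ m : ℝ, ∀ x, (m : EReal) ≤ h x

/-- `h` is proper, closed (lower semicontinuous) and bounded from below. -/
def ProperClosedBddBelow {E : Type*} [TopologicalSpace E] (h : E → EReal) : Prop :=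
  ProperFun h ∧ LowerSemicontinuous h ∧ BddBelowFun h

/-- `h` is level-bounded: all its sublevel sets at real levels are bounded. -/
def LevelBounded {E : Type*} [Bornology E] (h : E → EReal) : Prop :=
  ∀ t : ℝ, Bornology.IsBounded {x | h x ≤ (t : EReal)}

section Subdifferential

variable {E : Type*} [NormedAddCommGroup E] [InnerProductSpace ℝ E]

/-- The Fréchet subdifferential: `h y ≥ h x + ⟪D, y - x⟫ + o(‖y - x‖)` as `y → x`, where `h x` is
finite; that is, the lower limit of `(h y - h x - ⟪D, y - x⟫) / ‖y - x‖` as `y → x`, `y ≠ x`, is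
nonnegative. -/
def frechetSubdiff (h : E → EReal) (x : E) : Set E :=
  {D | h x ≠ ⊥ ∧ h x ≠ ⊤ ∧ ∀ ε : ℝ, 0 < ε →
    ∀ᶠ y in 𝓝 x, h x + ((inner ℝ D (y - x) - ε * ‖y - x‖ : ℝ) : EReal) ≤ h y}

/-- The limiting subdifferential (empty outside the domain of `h`). -/
def limitingSubdiff (h : E → EReal) (x : E) : Set E :=
  {D | h x ≠ ⊥ ∧ h x ≠ ⊤ ∧ ∃ (xs Ds : ℕ → E),
    Tendsto xs atTop (𝓝 x) ∧ Tendsto (fun k => h (xs k)) atTop (𝓝 (h x)) ∧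
    Tendsto Ds atTop (𝓝 D) ∧ ∀ k, Ds k ∈ frechetSubdiff h (xs k)}

/-- The Kurdyka-Łojasiewicz inequality for `h` at `x` with desingularizing function `φ` on
`[0, ν)`: `φ'(h y - h x) · dist(0, ∂h(y)) ≥ 1` for all `y` near `x` with
`h x < h y < h x + ν`. The distance to the empty set is `+∞`. -/
def KLInequality (h : E → EReal) (x : E) (ν : EReal) (φ : ℝ → ℝ) : Prop :=
  ∃ V ∈ 𝓝 x, ∀ y ∈ V, h x < h y → h y < h x + ν →
    1 ≤ ENNReal.ofReal (deriv φ (h y - h x).toReal) * Metric.infEDist 0 (limitingSubdiff h y)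

/-- `h` is a KL function with exponent `θ`: at each point where the subdifferential is nonempty,
the KL inequality holds with `φ(t) = a t ^ (1 - θ)` for some `a > 0` and some `ν ∈ (0, +∞]`.
(For `θ ∈ [0, 1)` such a `φ` is concave, vanishes and is continuous at `0`, and is `C¹` with
positive derivative on `(0, ν)`.) -/
def IsKLWithExponent (h : E → EReal) (θ : ℝ) : Prop :=
  ∀ x, (limitingSubdiff h x).Nonempty → ∃ (a : ℝ) (ν : EReal), 0 < a ∧ 0 < ν ∧
    KLInequality h x ν fun t => a * t ^ (1 - θ)

end Subdifferential

/-! ## The generalized symmetric matrix factorization problem -/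

/-- The data of the problem: regularizers `Ψ`, `Φ`, a linear map `A`, a vector `b` and a penalty
parameter `lam`. -/
structure GSMF (n r q : ℕ) where
  Ψ : Mat n r → EReal
  Φ : Mat n r → EReal
  A : Mat n n →L[ℝ] EuclideanSpace ℝ (Fin q)
  b : EuclideanSpace ℝ (Fin q)
  lam : ℝ

/-- The parameters of the algorithm. -/
structure ANAUMParams where
  α : ℝ
  β : ℝ
  γ : ℝ
  μmin : ℝ
  σmin : ℝ
  σmax : ℝ
  τ : ℝ
  c : ℝ
  pmin : ℝ

/-- `H_α(X, Y, Z) = (α / 2) ‖X Yᵀ - Z‖_F²`. -/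
def couplingH {n r : ℕ} (α : ℝ) (X Y : Mat n r) (Z : Mat n n) : ℝ :=
  α / 2 * ‖mulT X Y - Z‖ ^ 2

namespace GSMF

variable {n r q : ℕ} (P : GSMF n r q) (S : ANAUMParams)

/-- The objective
`F_λ(X, Y) = Ψ(X) + Φ(Y) + ½ ‖A(X Yᵀ) - b‖² + (λ / 2) ‖X - Y‖_F²`. -/
def objective (W : MatPair n r) : EReal :=
  P.Ψ W.fst + P.Φ W.snd +
    ((1 / 2 * ‖P.A (mulT W.fst W.snd) - P.b‖ ^ 2 + P.lam / 2 * ‖W.fst - W.snd‖ ^ 2 : ℝ) : EReal)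

/-- The objective with the two blocks as separate arguments. -/
abbrev F (X Y : Mat n r) : EReal := P.objective (WithLp.toLp 2 (X, Y))

/-- The self-adjoint map `A* A`. -/
def AstarA : Mat n n →L[ℝ] Mat n n := (ContinuousLinearMap.adjoint P.A) ∘L P.A

/-- `ρ = ‖I - β / (α + β) A* A‖²`. -/
def rho : ℝ :=
  ‖ContinuousLinearMap.id ℝ (Mat n n) - (S.β / (S.α + S.β)) • P.AstarA‖ ^ 2

/-- The admissible parameters of the algorithm. -/
structure Admissible : Prop where
  α_ne : S.α ≠ 0
  β_ne : S.β ≠ 0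
  inv_add_inv : 1 / S.α + 1 / S.β = 1
  γ_nonneg : 0 ≤ S.γ
  γ_psd : ((S.α + S.γ) • ContinuousLinearMap.id ℝ (Mat n n) + S.β • P.AstarA).IsPositive
  μmin_pos : 0 < S.μmin
  σmin_pos : 0 < S.σmin
  σmin_lt : S.σmin < S.σmax
  τ_gt : 1 < S.τ
  c_pos : 0 < S.c
  pmin_pos : 0 < S.pmin
  pmin_lt : S.pmin < 1

/-- The update of the auxiliary variable:
`Z = (I - β / (α + β) A* A)(X Yᵀ) + β / (α + β) A*(b)`. -/
def Zof (X Y : Mat n r) : Mat n n :=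
  (ContinuousLinearMap.id ℝ (Mat n n) - (S.β / (S.α + S.β)) • P.AstarA) (mulT X Y) +
    (S.β / (S.α + S.β)) • ContinuousLinearMap.adjoint P.A P.b

/-- `U` is a proximal update of the first block. -/
def ProxX (X Y : Mat n r) (μ : ℝ) (U : Mat n r) : Prop :=
  IsMinOn (fun T : Mat n r => P.Ψ T + ((couplingH S.α T Y (P.Zof S X Y) +
    P.lam / 2 * ‖T - Y‖ ^ 2 + μ / 2 * ‖T - X‖ ^ 2 : ℝ) : EReal)) Set.univ U

/-- `U` is a prox-linear update of the first block. -/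
def ProxLinX (X Y : Mat n r) (μ : ℝ) (U : Mat n r) : Prop :=
  IsMinOn (fun T : Mat n r => P.Ψ T +
    ((inner ℝ (gradient (fun T' => couplingH S.α T' Y (P.Zof S X Y)) X) (T - X) +
    P.lam / 2 * ‖T - Y‖ ^ 2 + μ / 2 * ‖T - X‖ ^ 2 : ℝ) : EReal)) Set.univ U

/-- `U` is a hierarchical-prox (column-by-column) update of the first block; it is available only
when `Ψ` is a sum of proper closed functions of the columns that are bounded from below. -/
def HierX (X Y : Mat n r) (μ : ℝ) (U : Mat n r) : Prop :=
  ∃ ψ : Fin r → EuclideanSpace ℝ (Fin n) → EReal,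
    (∀ i, ProperClosedBddBelow (ψ i)) ∧ (∀ T, P.Ψ T = ∑ i, ψ i (col T i)) ∧
    ∀ i, IsMinOn (fun t : EuclideanSpace ℝ (Fin n) => ψ i t +
      ((couplingH S.α (mixCols U i t X) Y (P.Zof S X Y) +
      P.lam / 2 * ‖t - col Y i‖ ^ 2 + μ / 2 * ‖t - col X i‖ ^ 2 : ℝ) : EReal)) Set.univ (col U i)

/-- The candidate `U` computed from `(X, Y)` with proximal parameter `μ` by one of the three
schemes. -/
def UpdateX (X Y : Mat n r) (μ : ℝ) (U : Mat n r) : Prop :=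
  P.ProxX S X Y μ U ∨ P.ProxLinX S X Y μ U ∨ P.HierX S X Y μ U

/-- `V` is a proximal update of the second block. -/
def ProxY (X Y U : Mat n r) (σ : ℝ) (V : Mat n r) : Prop :=
  IsMinOn (fun T : Mat n r => P.Φ T + ((couplingH S.α U T (P.Zof S X Y) +
    P.lam / 2 * ‖U - T‖ ^ 2 + σ / 2 * ‖T - Y‖ ^ 2 : ℝ) : EReal)) Set.univ V

/-- `V` is a prox-linear update of the second block. -/
def ProxLinY (X Y U : Mat n r) (σ : ℝ) (V : Mat n r) : Prop :=
  IsMinOn (fun T : Mat n r => P.Φ T +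
    ((inner ℝ (gradient (fun T' => couplingH S.α U T' (P.Zof S X Y)) Y) (T - Y) +
    P.lam / 2 * ‖U - T‖ ^ 2 + σ / 2 * ‖T - Y‖ ^ 2 : ℝ) : EReal)) Set.univ V

/-- `V` is a hierarchical-prox (column-by-column) update of the second block; it is available only
when `Φ` is a sum of proper closed functions of the columns that are bounded from below. -/
def HierY (X Y U : Mat n r) (σ : ℝ) (V : Mat n r) : Prop :=
  ∃ φ : Fin r → EuclideanSpace ℝ (Fin n) → EReal,
    (∀ i, ProperClosedBddBelow (φ i)) ∧ (∀ T, P.Φ T = ∑ i, φ i (col T i)) ∧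
    ∀ i, IsMinOn (fun t : EuclideanSpace ℝ (Fin n) => φ i t +
      ((couplingH S.α U (mixCols V i t Y) (P.Zof S X Y) +
      P.lam / 2 * ‖col U i - t‖ ^ 2 + σ / 2 * ‖t - col Y i‖ ^ 2 : ℝ) : EReal)) Set.univ (col V i)

/-- The candidate `V` computed from `(X, Y)` and `U` with proximal parameter `σ` by one of the
three schemes. -/
def UpdateY (X Y U : Mat n r) (σ : ℝ) (V : Mat n r) : Prop :=
  P.ProxY S X Y U σ V ∨ P.ProxLinY S X Y U σ V ∨ P.HierY S X Y U σ V

/-- The cap `(α + 2 γ ρ) ‖W‖² + c` (spectral norm): `μₖᵐᵃˣ` for `W = Yᵏ`, and `σₖᵐᵃˣ` for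
`W = U`. -/
def cap (W : Mat n r) : ℝ :=
  (S.α + 2 * S.γ * P.rho S) * specNorm W ^ 2 + S.c

/-- The line search criterion for the candidate `(U, V)` at `(X, Y)` with reference value `R`:
`F(U, V) - R ≤ -(c / 2) (‖U - X‖_F² + ‖V - Y‖_F²)`. -/
def LineSearch (X Y : Mat n r) (R : ℝ) (U V : Mat n r) : Prop :=
  P.F U V ≤ ((R - S.c / 2 * (‖U - X‖ ^ 2 + ‖V - Y‖ ^ 2) : ℝ) : EReal)

/-- `Trial X Y R μ₀ σ₀ μ σ U V`: the inner loop of the iteration at `(X, Y)` with reference value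
`R`, started from the proximal parameters `μ₀`, `σ₀`, may test the line search criterion on the
candidate `(U, V)`, computed with the proximal parameters `μ`, `σ`. A further candidate is computed
only after the criterion has failed: if `μ` is at its cap, then `U` is kept and `σ` is raised by
the factor `τ` up to its cap; otherwise both parameters are raised. -/
inductive Trial (X Y : Mat n r) (R μ₀ σ₀ : ℝ) : ℝ → ℝ → Mat n r → Mat n r → Prop
  | init {U V : Mat n r}
      (hU : P.UpdateX S X Y (min μ₀ (P.cap S Y)) U)
      (hV : P.UpdateY S X Y U σ₀ V) :
      Trial X Y R μ₀ σ₀ (min μ₀ (P.cap S Y)) σ₀ U V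
  | raiseSecond {μ σ : ℝ} {U V V' : Mat n r}
      (prev : Trial X Y R μ₀ σ₀ μ σ U V)
      (fail : ¬ P.LineSearch S X Y R U V)
      (atCap : μ = P.cap S Y)
      (hV : P.UpdateY S X Y U (min (S.τ * σ) (P.cap S U)) V') :
      Trial X Y R μ₀ σ₀ μ (min (S.τ * σ) (P.cap S U)) U V'
  | raiseBoth {μ σ : ℝ} {U V U' V' : Mat n r}
      (prev : Trial X Y R μ₀ σ₀ μ σ U V)
      (fail : ¬ P.LineSearch S X Y R U V)
      (belowCap : μ ≠ P.cap S Y)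
      (hU : P.UpdateX S X Y (min (S.τ * μ) (P.cap S Y)) U')
      (hV : P.UpdateY S X Y U' (S.τ * σ) V') :
      Trial X Y R μ₀ σ₀ (min (S.τ * μ) (P.cap S Y)) (S.τ * σ) U' V'

/-- `(Xᵏ, Yᵏ)` are the iterates and `Rₖ` the reference values of an (infinite) run of the
average-type nonmonotone alternating updating method. As `R₀` is real, the initial objective value
is finite. -/
structure IsANAUMRun (X Y : ℕ → Mat n r) (R : ℕ → ℝ) : Prop where
  start : (R 0 : EReal) = P.F (X 0) (Y 0)
  step : ∀ k, ∃ μ₀ σ₀ μ σ p : ℝ,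
    S.μmin ≤ μ₀ ∧ S.σmin ≤ σ₀ ∧ σ₀ ≤ S.σmax ∧
    P.Trial S (X k) (Y k) (R k) μ₀ σ₀ μ σ (X (k + 1)) (Y (k + 1)) ∧
    P.LineSearch S (X k) (Y k) (R k) (X (k + 1)) (Y (k + 1)) ∧
    S.pmin ≤ p ∧ p ≤ 1 ∧
    (R (k + 1) : EReal) = (((1 - p) * R k : ℝ) : EReal) + (p : EReal) * P.F (X (k + 1)) (Y (k + 1))

end GSMF

end

/-! Write f k for the objective values, d k for the length of the step from iterate k to k + 1, and
ζ for the limit of R. Only values and step lengths are followed; convergence of the iterates is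
never needed.

Averaging and the line search give p_min (R k - f (k+1)) ≤ R k - R (k+1) and (c/2) (d k)² ≤ R k - f
(k+1). So R decreases to ζ, d tends to 0, and |f (k+1) - ζ| ≤ (R k - ζ) / p_min: a rate for R is a
rate for f (`abs_sub_le_div`).

The algorithm enters through `exists_isMinorant_of_updates`: inside the level set of R 0 the
proximal parameters are bounded, and optimality of the block updates gives a subgradient of the
objective at iterate k + 1 of norm at most C d k. The smooth gradients match because α (X Yᵀ - Z) is
exactly the gradient of the data term. The subgradients come with global lower bounds whose
quadratic error is uniform in k, so they pass to cluster points: there the objective equals ζ and 0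
is a subgradient.

Hence the KL inequality is available at each cluster point and, by compactness, holds along the tail
with one constant: f (k+1) > ζ implies (f (k+1) - ζ)^θ ≤ M d k
(`eventually_rpow_le_of_isKLWithExponent`). Squaring bounds (f (k+1) - ζ)^(2θ) by a multiple of R k
- R (k+1). Writing R k - ζ = (f (k+1) - ζ) + (R k - f (k+1)) turns this into a recursion for R k -
ζ, whose decay is geometric or of power type according to θ. -/

/-! ### Decay of real sequences from one-step recursions -/

/-- The tangent line at 1 lies below the convex function x ↦ x ^ (-q). With s = x - 1 it follows
from Bernoulli's (1 + s)^q ≤ 1 + q s and (1 - q s)(1 + q s) ≤ 1. -/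
theorem one_sub_mul_le_rpow_neg {x q : ℝ} (hx : 0 < x) (hq0 : 0 ≤ q) (hq1 : q ≤ 1) :
    1 - q * (x - 1) ≤ x ^ (-q) := by
  have h := rpow_one_add_le_one_add_mul_self (s := x - 1) (by linarith) hq0 hq1
  rw [add_sub_cancel] at h
  have hpos : 0 < x ^ q := Real.rpow_pos_of_pos hx q
  rw [Real.rpow_neg hx.le, ← one_div, le_div_iff₀ hpos]
  rcases le_or_gt (1 - q * (x - 1)) 0 with h0 | h0
  · nlinarith [mul_nonneg (neg_nonneg.2 h0) hpos.le]
  · nlinarith [mul_le_mul_of_nonneg_left h h0.le, sq_nonneg (q * (x - 1))]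

/-- Discrete form of the differential inequality r' ≤ -r^(q+1) / M: the quantity r^(-q) grows by at
least q / M per step. A zero of r beyond N persists and is treated apart. The shift k + 1 in the
bound is there because r k will control f (k + 1). -/
theorem exists_le_mul_rpow_of_rpow_le_mul_sub {r : ℕ → ℝ} {q M : ℝ} {N : ℕ}
    (hr : ∀ k, 0 ≤ r k) (hq0 : 0 < q) (hq1 : q ≤ 1) (hM : 0 < M)
    (h : ∀ k, N ≤ k → r k ^ (q + 1) ≤ M * (r k - r (k + 1))) :
    ∃ C : ℝ, 0 < C ∧ ∀ᶠ k : ℕ in atTop, r k ≤ C * ((k : ℝ) + 1) ^ (-(1 / q)) := by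
  by_cases hz : ∃ k, N ≤ k ∧ r k = 0
  · obtain ⟨k, hk, hk0⟩ := hz
    have hall : ∀ j, r (k + j) = 0 := by
      intro j
      induction j with
      | zero => simpa using hk0
      | succ j ih =>
        have h1 := h (k + j) (by omega)
        rw [ih, Real.zero_rpow (by linarith)] at h1
        have h2 := hr (k + (j + 1))
        rw [← add_assoc] at h2 ⊢
        nlinarith
    refine ⟨1, one_pos, ?_⟩
    filter_upwards [eventually_ge_atTop k] with m hm
    obtain ⟨j, rfl⟩ := Nat.exists_eq_add_of_le hm
    rw [hall]
    positivity
  · push Not at hz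
    have hpos : ∀ k, N ≤ k → 0 < r k := fun k hk => lt_of_le_of_ne (hr k) (hz k hk).symm
    have hstep : ∀ k, N ≤ k → r k ^ (-q) + q / M ≤ r (k + 1) ^ (-q) := by
      intro k hk
      have h0 := hpos k hk
      have h1 := hpos (k + 1) (by omega)
      have ht := one_sub_mul_le_rpow_neg (div_pos h1 h0) hq0.le hq1
      rw [Real.div_rpow h1.le h0.le, le_div_iff₀ (Real.rpow_pos_of_pos h0 _)] at ht
      have hk' := h k hk
      have hA : r k ^ (q + 1) * (r k ^ (-q) * (1 / r k)) = 1 := by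
        rw [Real.rpow_add h0, Real.rpow_neg h0.le, Real.rpow_one]
        have := Real.rpow_pos_of_pos h0 q
        field_simp
      have hB : 0 < r k ^ (-q) * (1 / r k) := by
        have := Real.rpow_pos_of_pos h0 (-q)
        positivity
      have hC := mul_le_mul_of_nonneg_right hk' hB.le
      rw [hA] at hC
      have hD : q / M ≤ q * ((r k - r (k + 1)) * (r k ^ (-q) * (1 / r k))) := by
        rw [div_le_iff₀ hM]
        nlinarith
      have hE : (1 - q * (r (k + 1) / r k - 1)) * r k ^ (-q) =
          r k ^ (-q) + q * ((r k - r (k + 1)) * (r k ^ (-q) * (1 / r k))) := by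
        field_simp
        ring
      linarith
    have hsum : ∀ j : ℕ, (j : ℝ) * (q / M) ≤ r (N + j) ^ (-q) := by
      intro j
      induction j with
      | zero =>
        have := Real.rpow_pos_of_pos (hpos N le_rfl) (-q)
        simpa using this.le
      | succ j ih =>
        have := hstep (N + j) (by omega)
        push_cast
        rw [← add_assoc]
        linarith
    -- Half of the slope q / M is given up to absorb the offset N: for k = N + j ≥ 2N + 1 one has j
    -- ≥ (k + 1) / 2.
    refine ⟨(q / (2 * M)) ^ (-(1 / q)), by positivity, ?_⟩
    filter_upwards [eventually_ge_atTop (2 * N + 1)] with k hk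
    have h0 := hpos k (by omega)
    obtain ⟨j, rfl⟩ := Nat.exists_eq_add_of_le (show N ≤ k by omega)
    have hj : ((N + j : ℕ) : ℝ) + 1 ≤ 2 * j := by
      have : N + j + 1 ≤ 2 * j := by omega
      exact_mod_cast this
    have h1 : q / (2 * M) * (((N + j : ℕ) : ℝ) + 1) ≤ r (N + j) ^ (-q) := by
      refine le_trans ?_ (hsum j)
      have : q / (2 * M) * (2 * (j : ℝ)) = j * (q / M) := by field_simp
      rw [← this]
      gcongr
    have h2 := Real.rpow_le_rpow_of_nonpos (z := -(1 / q)) (by positivity) h1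
      (by simp [hq0.le])
    rw [← Real.rpow_mul h0.le, Real.mul_rpow (by positivity) (by positivity)] at h2
    have h3 : -q * -(1 / q) = 1 := by field_simp
    rwa [h3, Real.rpow_one] at h2

theorem exists_le_mul_pow_of_succ_le_mul {r : ℕ → ℝ} {η : ℝ} {N : ℕ} (hr : ∀ k, 0 ≤ r k)
    (hη : 0 < η) (h : ∀ k, N ≤ k → r (k + 1) ≤ η * r k) :
    ∃ C : ℝ, 0 < C ∧ ∀ᶠ k : ℕ in atTop, r k ≤ C * η ^ (k + 1) := by
  have hall : ∀ j, r (N + j) ≤ r N * η ^ j := by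
    intro j
    induction j with
    | zero => simp
    | succ j ih =>
      have := h (N + j) (by omega)
      rw [← add_assoc, pow_succ]
      nlinarith
  -- The added 1 keeps the constant positive when r N = 0.
  refine ⟨r N / η ^ (N + 1) + 1, by have := hr N; positivity, ?_⟩
  filter_upwards [eventually_ge_atTop N] with k hk
  obtain ⟨j, rfl⟩ := Nat.exists_eq_add_of_le hk
  have h1 : r N / η ^ (N + 1) * η ^ (N + j + 1) = r N * η ^ j := by
    rw [show N + j + 1 = (N + 1) + j by ring, pow_add η (N + 1), ← mul_assoc,
      div_mul_cancel₀ _ (by positivity)]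
  have h2 : 0 < η ^ (N + j + 1) := by positivity
  rw [add_mul, h1]
  linarith [hall j]

/-! ### Nonmonotone averaging and the three rates -/

section Averaging

variable {f R d p : ℕ → ℝ} {ζ pmin c M θ : ℝ}

/-- The recursion says R k - R (k+1) = p k (R k - f (k+1)), and sufficient decrease makes the last
factor nonnegative. -/
theorem averaged_succ_le (hc : 0 < c) (hp : ∀ k, pmin ≤ p k)
    (hR : ∀ k, R (k + 1) = (1 - p k) * R k + p k * f (k + 1))
    (hdesc : ∀ k, f (k + 1) ≤ R k - c / 2 * d k ^ 2) (k : ℕ) :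
    pmin * (R k - f (k + 1)) ≤ R k - R (k + 1) := by
  have h1 : 0 ≤ R k - f (k + 1) := by
    have := hdesc k
    nlinarith [sq_nonneg (d k)]
  rw [hR k]
  nlinarith [mul_le_mul_of_nonneg_right (hp k) h1]

theorem averaged_antitone (hc : 0 < c) (hpmin : 0 < pmin) (hp : ∀ k, pmin ≤ p k)
    (hR : ∀ k, R (k + 1) = (1 - p k) * R k + p k * f (k + 1))
    (hdesc : ∀ k, f (k + 1) ≤ R k - c / 2 * d k ^ 2) : Antitone R := by
  refine antitone_nat_of_succ_le fun k => ?_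
  have h1 := averaged_succ_le hc hp hR hdesc k
  have h2 := hdesc k
  have h3 : 0 ≤ R k - f (k + 1) := by nlinarith [sq_nonneg (d k)]
  nlinarith

/-- The values may lie on either side of ζ. Above, f (k+1) ≤ R k and p_min < 1 suffice; below, p_min
(R k - f (k+1)) ≤ R k - R (k+1) ≤ R k - ζ, as R stays above its limit. -/
theorem abs_sub_le_div (hc : 0 < c) (hpmin : 0 < pmin) (hpmin1 : pmin < 1)
    (hp : ∀ k, pmin ≤ p k)
    (hR : ∀ k, R (k + 1) = (1 - p k) * R k + p k * f (k + 1))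
    (hdesc : ∀ k, f (k + 1) ≤ R k - c / 2 * d k ^ 2) (hlim : Tendsto R atTop (𝓝 ζ)) (k : ℕ) :
    |f (k + 1) - ζ| ≤ (R k - ζ) / pmin := by
  have hanti := averaged_antitone hc hpmin hp hR hdesc
  have h0 : ζ ≤ R k := hanti.le_of_tendsto hlim k
  have h0' : ζ ≤ R (k + 1) := hanti.le_of_tendsto hlim (k + 1)
  have h1 := averaged_succ_le hc hp hR hdesc k
  have h2 : f (k + 1) ≤ R k := by
    have := hdesc k
    nlinarith [sq_nonneg (d k)]
  rw [le_div_iff₀ hpmin]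
  rcases abs_cases (f (k + 1) - ζ) with ⟨h, _⟩ | ⟨h, _⟩ <;> rw [h] <;> nlinarith

theorem tendsto_values_of_averaged (hc : 0 < c) (hpmin : 0 < pmin) (hpmin1 : pmin < 1)
    (hp : ∀ k, pmin ≤ p k)
    (hR : ∀ k, R (k + 1) = (1 - p k) * R k + p k * f (k + 1))
    (hdesc : ∀ k, f (k + 1) ≤ R k - c / 2 * d k ^ 2) (hlim : Tendsto R atTop (𝓝 ζ)) :
    Tendsto f atTop (𝓝 ζ) := by
  rw [← tendsto_add_atTop_iff_nat 1, tendsto_iff_norm_sub_tendsto_zero]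
  refine squeeze_zero (fun k => norm_nonneg _)
    (fun k => abs_sub_le_div hc hpmin hpmin1 hp hR hdesc hlim k) ?_
  have := (hlim.sub_const ζ).div_const pmin
  simpa using this

theorem tendsto_steps_of_averaged (hc : 0 < c) (hpmin : 0 < pmin) (hpmin1 : pmin < 1)
    (hp : ∀ k, pmin ≤ p k)
    (hR : ∀ k, R (k + 1) = (1 - p k) * R k + p k * f (k + 1))
    (hdesc : ∀ k, f (k + 1) ≤ R k - c / 2 * d k ^ 2) (hlim : Tendsto R atTop (𝓝 ζ)) :
    Tendsto d atTop (𝓝 0) := by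
  have hf := tendsto_values_of_averaged hc hpmin hpmin1 hp hR hdesc hlim
  have h1 : Tendsto (fun k => 2 / c * (R k - f (k + 1))) atTop (𝓝 0) := by
    have := (hlim.sub ((tendsto_add_atTop_iff_nat 1).2 hf)).const_mul (2 / c)
    simpa using this
  have h2 : Tendsto (fun k => d k ^ 2) atTop (𝓝 0) := by
    refine squeeze_zero (fun k => sq_nonneg _) (fun k => ?_) h1
    rw [div_mul_eq_mul_div, le_div_iff₀ hc]
    linarith [hdesc k]
  have h3 := h2.sqrt
  simp only [Real.sqrt_sq_eq_abs, Real.sqrt_zero] at h3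
  exact (tendsto_zero_iff_abs_tendsto_zero _).2 h3

theorem rpow_two_mul_le_of_step (hc : 0 < c) (hpmin : 0 < pmin) (hp : ∀ k, pmin ≤ p k)
    (hR : ∀ k, R (k + 1) = (1 - p k) * R k + p k * f (k + 1))
    (hdesc : ∀ k, f (k + 1) ≤ R k - c / 2 * d k ^ 2) {k : ℕ} (he : ζ < f (k + 1))
    (h : (f (k + 1) - ζ) ^ θ ≤ M * d k) :
    (f (k + 1) - ζ) ^ (2 * θ) ≤ M ^ 2 * (2 / (c * pmin)) * (R k - R (k + 1)) := by
  have h1 := averaged_succ_le hc hp hR hdesc k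
  have h2 : d k ^ 2 ≤ 2 / (c * pmin) * (R k - R (k + 1)) := by
    rw [div_mul_eq_mul_div, le_div_iff₀ (by positivity)]
    nlinarith [hdesc k]
  have h3 : (f (k + 1) - ζ) ^ (2 * θ) = ((f (k + 1) - ζ) ^ θ) ^ 2 := by
    rw [mul_comm, Real.rpow_mul (by linarith)]
    norm_cast
  have h4 : 0 ≤ (f (k + 1) - ζ) ^ θ := Real.rpow_nonneg (by linarith) _
  calc (f (k + 1) - ζ) ^ (2 * θ) = ((f (k + 1) - ζ) ^ θ) ^ 2 := h3
    _ ≤ (M * d k) ^ 2 := by gcongr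
    _ = M ^ 2 * d k ^ 2 := by ring
    _ ≤ M ^ 2 * (2 / (c * pmin) * (R k - R (k + 1))) := by gcongr
    _ = _ := by ring

/-- For θ = 0 the KL inequality forces 1 ≤ M d k, impossible once the steps are small. So eventually
f (k+1) ≤ ζ, whence R k - R (k+1) ≥ p_min (R k - ζ): a contraction by 1 - p_min. -/
theorem finite_identification_rate (hc : 0 < c) (hpmin : 0 < pmin) (hpmin1 : pmin < 1)
    (hp : ∀ k, pmin ≤ p k)
    (hR : ∀ k, R (k + 1) = (1 - p k) * R k + p k * f (k + 1))
    (hdesc : ∀ k, f (k + 1) ≤ R k - c / 2 * d k ^ 2) (hlim : Tendsto R atTop (𝓝 ζ))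
    (hKL : ∀ᶠ k in atTop, ζ < f (k + 1) → 1 ≤ M * d k) :
    ∃ c₁ η₁ : ℝ, 0 < c₁ ∧ 0 < η₁ ∧ η₁ < 1 ∧
      ∀ᶠ k in atTop, ζ - c₁ * η₁ ^ k ≤ f k ∧ f k ≤ ζ := by
  have hanti := averaged_antitone hc hpmin hp hR hdesc
  have hd := (tendsto_steps_of_averaged hc hpmin hpmin1 hp hR hdesc hlim).const_mul M
  rw [mul_zero] at hd
  obtain ⟨N, hN⟩ := eventually_atTop.1 (hKL.and (hd.eventually_lt_const one_pos))
  have hle : ∀ k, N ≤ k → f (k + 1) ≤ ζ := fun k hk => by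
    by_contra! hlt
    linarith [(hN k hk).1 hlt, (hN k hk).2]
  obtain ⟨C, hC, hCk⟩ := exists_le_mul_pow_of_succ_le_mul (r := fun k => R k - ζ)
    (η := 1 - pmin) (N := N) (fun k => sub_nonneg.2 (hanti.le_of_tendsto hlim k))
    (by linarith) (fun k hk => by
      have h1 := averaged_succ_le hc hp hR hdesc k
      have h2 := hle k hk
      nlinarith)
  refine ⟨C / pmin, 1 - pmin, by positivity, by linarith, by linarith, ?_⟩
  obtain ⟨N', hN'⟩ := eventually_atTop.1 hCk
  filter_upwards [eventually_ge_atTop (N + N' + 1)] with m hm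
  obtain ⟨k, rfl⟩ : ∃ k, m = k + 1 := ⟨m - 1, by omega⟩
  refine ⟨?_, hle k (by omega)⟩
  have h1 := abs_sub_le_div hc hpmin hpmin1 hp hR hdesc hlim k
  have h2 := div_le_div_of_nonneg_right (hN' k (by omega)) hpmin.le
  have h3 := neg_abs_le (f (k + 1) - ζ)
  have h4 : C * (1 - pmin) ^ (k + 1) / pmin = C / pmin * (1 - pmin) ^ (k + 1) := by ring
  linarith

/-- Both parts of R k - ζ = (f (k+1) - ζ) + (R k - f (k+1)) are bounded by multiples of R k - R
(k+1); for the first, t ≤ t^(2θ) when 0 < t ≤ 1 and 2θ ≤ 1. -/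
theorem linear_rate (hc : 0 < c) (hpmin : 0 < pmin) (hpmin1 : pmin < 1)
    (hp : ∀ k, pmin ≤ p k)
    (hR : ∀ k, R (k + 1) = (1 - p k) * R k + p k * f (k + 1))
    (hdesc : ∀ k, f (k + 1) ≤ R k - c / 2 * d k ^ 2) (hlim : Tendsto R atTop (𝓝 ζ))
    (hKL : ∀ᶠ k in atTop, ζ < f (k + 1) → (f (k + 1) - ζ) ^ θ ≤ M * d k)
    (hθ : θ ≤ 1 / 2) :
    ∃ c₂ η₂ : ℝ, 0 < c₂ ∧ 0 < η₂ ∧ η₂ < 1 ∧ ∀ᶠ k in atTop, |f k - ζ| ≤ c₂ * η₂ ^ k := by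
  have hanti := averaged_antitone hc hpmin hp hR hdesc
  have hf := (tendsto_add_atTop_iff_nat 1).2
    (tendsto_values_of_averaged hc hpmin hpmin1 hp hR hdesc hlim)
  obtain ⟨N, hN⟩ := eventually_atTop.1
    (hKL.and (hf.eventually_lt_const (show ζ < ζ + 1 by linarith)))
  -- The final 1 makes M' > 1 visible, so that the ratio 1 - 1 / M' is positive.
  set M' : ℝ := M ^ 2 * (2 / (c * pmin)) + 1 / pmin + 1 with hM'
  have hpinv : 0 < 1 / pmin := by positivity
  have hMnn : 0 ≤ M ^ 2 * (2 / (c * pmin)) := by positivity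
  have hM1 : 1 < M' := by linarith
  have key : ∀ k, N ≤ k → R k - ζ ≤ M' * (R k - R (k + 1)) := by
    intro k hk
    have h1 := averaged_succ_le hc hp hR hdesc k
    have h1' : R k - f (k + 1) ≤ 1 / pmin * (R k - R (k + 1)) := by
      rw [one_div, ← div_eq_inv_mul, le_div_iff₀ hpmin]
      linarith
    have hΔ : 0 ≤ R k - R (k + 1) := sub_nonneg.2 (hanti k.le_succ)
    have hA : 0 ≤ M ^ 2 * (2 / (c * pmin)) * (R k - R (k + 1)) := mul_nonneg hMnn hΔ
    have hexp : M' * (R k - R (k + 1)) = M ^ 2 * (2 / (c * pmin)) * (R k - R (k + 1)) +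
      1 / pmin * (R k - R (k + 1)) + (R k - R (k + 1)) := by rw [hM']; ring
    rcases le_or_gt (f (k + 1)) ζ with he | he
    · linarith
    · have h2 := rpow_two_mul_le_of_step hc hpmin hp hR hdesc he ((hN k hk).1 he)
      have h3 : f (k + 1) - ζ ≤ (f (k + 1) - ζ) ^ (2 * θ) := by
        have := Real.rpow_le_rpow_of_exponent_ge (x := f (k + 1) - ζ) (y := 1) (z := 2 * θ)
          (by linarith) (by linarith [(hN k hk).2]) (by linarith)
        rwa [Real.rpow_one] at this
      linarith
  have hη : 0 < 1 - 1 / M' := by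
    rw [sub_pos, div_lt_one (by linarith)]
    exact hM1
  have hη1 : 1 - 1 / M' < 1 := by
    have : 0 < 1 / M' := by positivity
    linarith
  obtain ⟨C, hC, hCk⟩ := exists_le_mul_pow_of_succ_le_mul (r := fun k => R k - ζ)
    (η := 1 - 1 / M') (N := N) (fun k => sub_nonneg.2 (hanti.le_of_tendsto hlim k))
    hη (fun k hk => by
      have h1 : (R k - ζ) / M' ≤ R k - R (k + 1) := by
        rw [div_le_iff₀ (by linarith)]
        linarith [key k hk]
      have h2 : (1 - 1 / M') * (R k - ζ) = (R k - ζ) - (R k - ζ) / M' := by ring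
      simp only [h2]
      linarith)
  refine ⟨C / pmin, 1 - 1 / M', by positivity, hη, hη1, ?_⟩
  obtain ⟨N', hN'⟩ := eventually_atTop.1 hCk
  filter_upwards [eventually_ge_atTop (N' + 1)] with m hm
  obtain ⟨k, rfl⟩ : ∃ k, m = k + 1 := ⟨m - 1, by omega⟩
  have h1 := abs_sub_le_div hc hpmin hpmin1 hp hR hdesc hlim k
  have h2 := div_le_div_of_nonneg_right (hN' k (by omega)) hpmin.le
  have h4 : C * (1 - 1 / M') ^ (k + 1) / pmin = C / pmin * (1 - 1 / M') ^ (k + 1) := by ring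
  linarith

/-- The power 2θ > 1 does not split over the sum (f (k+1) - ζ) + (R k - f (k+1)), but one summand is
at least t = (R k - ζ) / 2. If it is the first, KL bounds t^(2θ); otherwise t^(2θ) ≤ t ≤ R k - f
(k+1). The recursion for t then has exponent 1 + q with q = 2θ - 1. -/
theorem sublinear_rate (hc : 0 < c) (hpmin : 0 < pmin) (hpmin1 : pmin < 1)
    (hp : ∀ k, pmin ≤ p k)
    (hR : ∀ k, R (k + 1) = (1 - p k) * R k + p k * f (k + 1))
    (hdesc : ∀ k, f (k + 1) ≤ R k - c / 2 * d k ^ 2) (hlim : Tendsto R atTop (𝓝 ζ))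
    (hKL : ∀ᶠ k in atTop, ζ < f (k + 1) → (f (k + 1) - ζ) ^ θ ≤ M * d k)
    (hθ : 1 / 2 < θ) (hθ1 : θ < 1) :
    ∃ c₃ : ℝ, 0 < c₃ ∧
      ∀ᶠ k : ℕ in atTop, |f k - ζ| ≤ c₃ * (k : ℝ) ^ (-(1 / (2 * θ - 1))) := by
  have hanti := averaged_antitone hc hpmin hp hR hdesc
  obtain ⟨N, hN⟩ := eventually_atTop.1
    (hKL.and (hlim.eventually_lt_const (show ζ < ζ + 1 by linarith)))
  set M' : ℝ := M ^ 2 * (2 / (c * pmin)) + 1 / pmin with hM'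
  have hpinv : 0 < 1 / pmin := by positivity
  have hMnn : 0 ≤ M ^ 2 * (2 / (c * pmin)) := by positivity
  have hM0 : 0 < M' := by linarith
  have hr : ∀ k, 0 ≤ (R k - ζ) / 2 := fun k => by
    have := hanti.le_of_tendsto hlim k
    linarith
  have key : ∀ k, N ≤ k →
      ((R k - ζ) / 2) ^ ((2 * θ - 1) + 1) ≤ 2 * M' * ((R k - ζ) / 2 - (R (k + 1) - ζ) / 2) := by
    intro k hk
    have h1 := averaged_succ_le hc hp hR hdesc k
    have h1' : R k - f (k + 1) ≤ 1 / pmin * (R k - R (k + 1)) := by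
      rw [one_div, ← div_eq_inv_mul, le_div_iff₀ hpmin]
      linarith
    have hΔ : 0 ≤ R k - R (k + 1) := sub_nonneg.2 (hanti k.le_succ)
    have hA : 0 ≤ M ^ 2 * (2 / (c * pmin)) * (R k - R (k + 1)) := mul_nonneg hMnn hΔ
    have hA' : 0 ≤ 1 / pmin * (R k - R (k + 1)) := mul_nonneg hpinv.le hΔ
    have hexp : 2 * M' * ((R k - ζ) / 2 - (R (k + 1) - ζ) / 2) =
      M ^ 2 * (2 / (c * pmin)) * (R k - R (k + 1)) + 1 / pmin * (R k - R (k + 1)) := by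
      rw [hM']; ring
    rw [hexp, sub_add_cancel]
    have hrk := hr k
    have hr1 : (R k - ζ) / 2 ≤ 1 := by linarith [(hN k hk).2]
    rcases le_or_gt ((R k - ζ) / 2) (f (k + 1) - ζ) with he | he
    · rcases hrk.eq_or_lt with h0 | h0
      · rw [← h0, Real.zero_rpow (by linarith)]
        linarith
      · have hlt : ζ < f (k + 1) := by linarith
        have h2 := rpow_two_mul_le_of_step hc hpmin hp hR hdesc hlt ((hN k hk).1 hlt)
        have h3 := Real.rpow_le_rpow hrk he (show 0 ≤ 2 * θ by linarith)
        linarith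
    · have h3 : ((R k - ζ) / 2) ^ (2 * θ) ≤ (R k - ζ) / 2 := by
        rcases hrk.eq_or_lt with h0 | h0
        · rw [← h0, Real.zero_rpow (by linarith)]
        · have := Real.rpow_le_rpow_of_exponent_ge (x := (R k - ζ) / 2) (y := 2 * θ) (z := 1)
            h0 hr1 (by linarith)
          rwa [Real.rpow_one] at this
      linarith
  obtain ⟨C, hC, hCk⟩ := exists_le_mul_rpow_of_rpow_le_mul_sub (r := fun k => (R k - ζ) / 2)
    hr (q := 2 * θ - 1) (by linarith) (by linarith) (show 0 < 2 * M' by positivity) key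
  refine ⟨2 * C / pmin, by positivity, ?_⟩
  obtain ⟨N', hN'⟩ := eventually_atTop.1 hCk
  filter_upwards [eventually_ge_atTop (N' + 1)] with m hm
  obtain ⟨k, rfl⟩ : ∃ k, m = k + 1 := ⟨m - 1, by omega⟩
  have h1 := abs_sub_le_div hc hpmin hpmin1 hp hR hdesc hlim k
  have h2 : R k - ζ ≤ 2 * (C * ((k : ℝ) + 1) ^ (-(1 / (2 * θ - 1)))) := by
    have := hN' k (by omega)
    linarith
  have h3 := div_le_div_of_nonneg_right h2 hpmin.le
  push_cast
  have h4 : 2 * (C * ((k : ℝ) + 1) ^ (-(1 / (2 * θ - 1)))) / pmin =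
    2 * C / pmin * ((k : ℝ) + 1) ^ (-(1 / (2 * θ - 1))) := by ring
  linarith

end Averaging

/-! ### Subgradients with global lower bounds, and the uniform KL inequality -/

section GlobalMinorants

variable {E : Type*} [NormedAddCommGroup E] [InnerProductSpace ℝ E]

/-- `x ↦ a + s x - (first order expansion of s at w) + ⟪D, x - w⟫ - K ‖x - w‖²` minorizes `F`;
with `F w = a` and `s` differentiable this makes `D` a Fréchet subgradient of `F` at `w`. -/
def IsMinorant (F : E → EReal) (s : E → ℝ) (K a : ℝ) (w D : E) : Prop :=
  ∀ v, ((a + s v - s w - fderiv ℝ s w (v - w) + inner ℝ D (v - w) - K * ‖v - w‖ ^ 2 : ℝ) : EReal)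
    ≤ F v

theorem IsMinorant.mem_frechetSubdiff {F : E → EReal} {s : E → ℝ} {K a : ℝ} {w D : E}
    (h : IsMinorant F s K a w D) (hF : F w = (a : ℝ)) (hs : DifferentiableAt ℝ s w) :
    D ∈ frechetSubdiff F w := by
  refine ⟨by simp [hF], by simp [hF], fun ε hε => ?_⟩
  have h1 := hs.hasFDerivAt.isLittleO.def (half_pos hε)
  have h2 : Tendsto (fun v => |K| * ‖v - w‖) (𝓝 w) (𝓝 0) := by
    have : Continuous fun v => |K| * ‖v - w‖ := by fun_prop
    simpa using this.tendsto w
  filter_upwards [h1, h2.eventually_le_const (half_pos hε)] with v hv1 hv2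
  refine le_trans ?_ (h v)
  rw [hF, ← EReal.coe_add, EReal.coe_le_coe_iff]
  have h3 := (abs_le.1 (Real.norm_eq_abs _ ▸ hv1)).1
  have h4 : K * ‖v - w‖ ^ 2 ≤ ε / 2 * ‖v - w‖ := by
    have := mul_le_mul_of_nonneg_right hv2 (norm_nonneg (v - w))
    have := mul_le_mul_of_nonneg_right (le_abs_self K) (sq_nonneg ‖v - w‖)
    nlinarith
  linarith

theorem frechetSubdiff_subset_limitingSubdiff (F : E → EReal) (x : E) :
    frechetSubdiff F x ⊆ limitingSubdiff F x := fun D hD =>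
  ⟨hD.1, hD.2.1, fun _ => x, fun _ => D, tendsto_const_nhds, tendsto_const_nhds,
    tendsto_const_nhds, fun _ => hD⟩

/-- At a limit of points with vanishing subgradients coming from uniform minorants, the values
converge and `0` is a limiting subgradient. -/
theorem eq_and_zero_mem_limitingSubdiff {F : E → EReal} {s : E → ℝ} {K ζ : ℝ} {w D : ℕ → E}
    {f : ℕ → ℝ} {x : E} (hF : LowerSemicontinuous F) (hs : ContDiff ℝ 1 s)
    (hfF : ∀ j, F (w j) = f j) (hmin : ∀ j, IsMinorant F s K (f j) (w j) (D j))
    (hw : Tendsto w atTop (𝓝 x)) (hf : Tendsto f atTop (𝓝 ζ)) (hD : Tendsto D atTop (𝓝 0)) :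
    F x = ζ ∧ (0 : E) ∈ limitingSubdiff F x := by
  have hfE : Tendsto (fun j => (f j : EReal)) atTop (𝓝 (ζ : EReal)) :=
    (continuous_coe_real_ereal.tendsto ζ).comp hf
  have hx : F x = ζ := by
    apply le_antisymm
    -- Lower semicontinuity gives F x ≤ ζ.
    · refine le_of_forall_lt fun c hc => ?_
      by_contra! hle
      obtain ⟨c', hc1, hc2⟩ := exists_between hc
      have h1 := hw.eventually (hF x c' hc2)
      have h2 := ge_of_tendsto hfE (h1.mono fun j hj => (by rw [← hfF]; exact hj.le : c' ≤ f j))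
      exact absurd (hc1.trans_le h2) (not_lt.2 hle)
    -- For ζ ≤ F x, each minorant is evaluated at the fixed point x; with K independent of j, every
    -- correction vanishes in the limit.
    · have hw0 : Tendsto (fun j => x - w j) atTop (𝓝 0) := by
        simpa using hw.const_sub x
      have hs1 : Tendsto (fun j => fderiv ℝ s (w j) (x - w j)) atTop (𝓝 0) := by
        have := ((hs.continuous_fderiv_apply one_ne_zero).tendsto (x, (0 : E))).comp
          (hw.prodMk_nhds hw0)
        simpa [Function.comp_def] using this
      have hs0 : Tendsto (fun j => s (w j)) atTop (𝓝 (s x)) := (hs.continuous.tendsto x).comp hw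
      have hn : Tendsto (fun j => K * ‖x - w j‖ ^ 2) atTop (𝓝 0) := by
        simpa using (hw0.norm.pow 2).const_mul K
      have hi : Tendsto (fun j => inner ℝ (D j) (x - w j)) atTop (𝓝 0) := by
        simpa using hD.inner (𝕜 := ℝ) hw0
      have hlim := ((((hf.add_const (s x)).sub hs0).sub hs1).add hi).sub hn
      simp only [add_sub_cancel_right, sub_zero, add_zero] at hlim
      exact le_of_tendsto' ((continuous_coe_real_ereal.tendsto ζ).comp hlim) fun j => hmin j x
  refine ⟨hx, by simp [hx], by simp [hx], w, D, hw, ?_, hD, fun j =>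
    (hmin j).mem_frechetSubdiff (hfF j) (hs.differentiable one_ne_zero _)⟩
  simp only [hfF, hx]
  exact hfE

theorem rpow_le_of_one_le_deriv_mul {a θ t δ : ℝ} {I : ENNReal} (ha : 0 < a) (hθ1 : θ < 1)
    (ht : 0 < t) (hI : I ≤ ENNReal.ofReal δ)
    (h : 1 ≤ ENNReal.ofReal (deriv (fun t : ℝ => a * t ^ (1 - θ)) t) * I) :
    t ^ θ ≤ a * (1 - θ) * δ := by
  have hd : deriv (fun t : ℝ => a * t ^ (1 - θ)) t = a * (1 - θ) * t ^ (-θ) := by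
    have := ((Real.hasDerivAt_rpow_const (x := t) (p := 1 - θ) (Or.inl ht.ne')).const_mul a).deriv
    rw [this, show 1 - θ - 1 = -θ by ring]
    ring
  have htp := Real.rpow_pos_of_pos ht (-θ)
  have hnn : 0 ≤ a * (1 - θ) * t ^ (-θ) :=
    mul_nonneg (mul_nonneg ha.le (by linarith)) htp.le
  have h1 := h.trans (mul_le_mul_right hI _)
  rw [hd, ← ENNReal.ofReal_mul hnn, ENNReal.one_le_ofReal, Real.rpow_neg ht.le] at h1
  have htθ := Real.rpow_pos_of_pos ht θ
  calc t ^ θ = t ^ θ * 1 := by ring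
    _ ≤ t ^ θ * (a * (1 - θ) * (t ^ θ)⁻¹ * δ) := by gcongr
    _ = a * (1 - θ) * δ := by field_simp

/-- The KL inequality holds uniformly along a bounded sequence whose values converge and which has
small subgradients. -/
theorem eventually_rpow_le_of_isKLWithExponent [ProperSpace E] {F : E → EReal} {s : E → ℝ}
    {K C ζ θ : ℝ} {w D : ℕ → E} {f d : ℕ → ℝ} (hF : LowerSemicontinuous F)
    (hs : ContDiff ℝ 1 s) (hθ1 : θ < 1) (hKL : IsKLWithExponent F θ)
    (hfF : ∀ j, F (w j) = f j) (hmin : ∀ j, IsMinorant F s K (f j) (w j) (D j))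
    (hD : ∀ j, ‖D j‖ ≤ C * d j) (hd : Tendsto d atTop (𝓝 0)) (hf : Tendsto f atTop (𝓝 ζ))
    (hb : Bornology.IsBounded (Set.range w)) :
    ∃ M : ℝ, ∀ᶠ j in atTop, ζ < f j → (f j - ζ) ^ θ ≤ M * d j := by
  have hD0 : Tendsto D atTop (𝓝 0) :=
    squeeze_zero_norm hD (by simpa using hd.const_mul C)
  have hCd : ∀ j, 0 ≤ C * d j := fun j => (norm_nonneg _).trans (hD j)
  suffices h : ∃ M : ℝ, 0 ≤ M ∧ ∀ᶠ j in atTop, w j ∈ closure (Set.range w) → ζ < f j →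
      (f j - ζ) ^ θ ≤ M * (C * d j) by
    obtain ⟨M, -, hM⟩ := h
    refine ⟨M * C, hM.mono fun j hj hlt => ?_⟩
    rw [mul_assoc]
    exact hj (subset_closure ⟨j, rfl⟩) hlt
  -- The property of S is that one constant serves all late indices with w j ∈ S. It passes to
  -- subsets and unions, so by compactness it need only hold near each point.
  refine hb.isCompact_closure.induction_on
    (p := fun S => ∃ M : ℝ, 0 ≤ M ∧ ∀ᶠ j in atTop, w j ∈ S → ζ < f j →
      (f j - ζ) ^ θ ≤ M * (C * d j)) ⟨0, le_rfl, by simp⟩ ?_ ?_ ?_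
  · rintro S T hST ⟨M, hM0, hM⟩
    exact ⟨M, hM0, hM.mono fun j hj hjS => hj (hST hjS)⟩
  · rintro S T ⟨M, hM0, hM⟩ ⟨M', hM0', hM'⟩
    refine ⟨M + M', add_nonneg hM0 hM0', ?_⟩
    filter_upwards [hM, hM'] with j hj hj' hjS hlt
    have h1 := mul_nonneg hM0 (hCd j)
    have h2 := mul_nonneg hM0' (hCd j)
    rw [add_mul]
    rcases hjS with hjS | hjT
    · linarith [hj hjS hlt]
    · linarith [hj' hjT hlt]
  · intro x _
    by_cases hx : MapClusterPt x atTop w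
    -- At a cluster point, 0 is a limiting subgradient and the value is ζ, so the KL inequality
    -- there controls exactly f j - ζ.
    · obtain ⟨φ, hφ, hφx⟩ := hx.tendsto_subseq
      obtain ⟨hFx, h0⟩ := eq_and_zero_mem_limitingSubdiff hF hs (w := w ∘ φ) (f := f ∘ φ)
        (D := D ∘ φ) (fun j => hfF _) (fun j => hmin _) hφx (hf.comp hφ.tendsto_atTop)
        (hD0.comp hφ.tendsto_atTop)
      obtain ⟨a, ν, ha, hν, V, hV, hVy⟩ := hKL x ⟨0, h0⟩
      refine ⟨V, mem_nhdsWithin_of_mem_nhds hV, a * (1 - θ),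
        mul_nonneg ha.le (by linarith), ?_⟩
      have hlt : (ζ : EReal) < ζ + ν := by
        have := EReal.add_lt_add_left_coe hν ζ
        simpa using this
      have hev := ((continuous_coe_real_ereal.tendsto ζ).comp hf).eventually_lt_const hlt
      filter_upwards [hev] with j hj hjV hζ
      have h1 := hVy (w j) hjV (by rw [hFx, hfF]; exact_mod_cast hζ) (by rw [hFx, hfF]; exact hj)
      rw [hFx, hfF, ← EReal.coe_sub, EReal.toReal_coe] at h1
      refine rpow_le_of_one_le_deriv_mul ha hθ1 (sub_pos.2 hζ) ?_ h1
      have hmem : D j ∈ limitingSubdiff F (w j) := frechetSubdiff_subset_limitingSubdiff F _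
        ((hmin j).mem_frechetSubdiff (hfF j) (hs.differentiable one_ne_zero _))
      refine (Metric.infEDist_le_edist_of_mem hmem).trans ?_
      rw [edist_dist, dist_zero_left]
      exact ENNReal.ofReal_le_ofReal (hD j)
    -- A point that is not a cluster point has a neighborhood that the sequence eventually avoids,
    -- so the claim is vacuous with M = 0.
    · rw [mapClusterPt_iff_frequently] at hx
      push Not at hx
      obtain ⟨V, hV, hVn⟩ := hx
      refine ⟨V, mem_nhdsWithin_of_mem_nhds hV, 0, le_rfl, ?_⟩
      filter_upwards [hVn] with j hj hjV
      exact absurd hjV hj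

end GlobalMinorants

noncomputable section

theorem coe_sum_ereal {ι : Type*} (s : Finset ι) (g : ι → ℝ) :
    ((∑ i ∈ s, g i : ℝ) : EReal) = ∑ i ∈ s, (g i : EReal) := by
  classical
  induction s using Finset.induction_on with
  | empty => simp
  | insert i s hi ih => rw [Finset.sum_insert hi, Finset.sum_insert hi, EReal.coe_add, ih]

/-! ### First-order information from minimality with quadratic error -/

section QuadMinorant

variable {V G : Type*} [NormedAddCommGroup V] [InnerProductSpace ℝ V]
  [NormedAddCommGroup G] [InnerProductSpace ℝ G]

/-- `h u` is a real number `a`, and `T ↦ a - ⟪e, T - u⟫ - K ‖T - u‖²` minorizes `h`; that is,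
`-e` is a proximal subgradient of `h` at `u`, with a global quadratic error. -/
def QuadMinorant (h : V → EReal) (K : ℝ) (u e : V) : Prop :=
  ∃ a : ℝ, h u = a ∧ ∀ T, ((a - inner ℝ e (T - u) - K * ‖T - u‖ ^ 2 : ℝ) : EReal) ≤ h T

theorem QuadMinorant.mono {h : V → EReal} {K K' : ℝ} {u e : V} (hq : QuadMinorant h K u e)
    (hK : K ≤ K') : QuadMinorant h K' u e := by
  obtain ⟨a, ha, hT⟩ := hq
  refine ⟨a, ha, fun T => le_trans ?_ (hT T)⟩
  rw [EReal.coe_le_coe_iff]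
  gcongr

/-- Minimality turns an upper quadratic bound for g at u into a lower one for h. Properness makes
the value of h at the minimizer finite. -/
theorem quadMinorant_of_isMinOn {h : V → EReal} (hh : ProperFun h) {g : V → ℝ} {K : ℝ} {u e : V}
    (hu : IsMinOn (fun T => h T + (g T : EReal)) Set.univ u)
    (hg : ∀ T, g T - g u ≤ inner ℝ e (T - u) + K * ‖T - u‖ ^ 2) : QuadMinorant h K u e := by
  have hle : ∀ T, h u + (g u : EReal) ≤ h T + (g T : EReal) := fun T => hu (Set.mem_univ T)
  obtain ⟨T₀, hT₀⟩ := hh.2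
  have htop : h u ≠ ⊤ := by
    intro h0
    have h1 := hle T₀
    rw [h0, EReal.top_add_coe] at h1
    exact h1.not_gt (EReal.add_lt_top hT₀ (EReal.coe_ne_top _))
  lift h u to ℝ using ⟨htop, hh.1 u⟩ with a ha
  refine ⟨a, ha.symm, fun T => ?_⟩
  have h1 := hle T
  have h2 := hg T
  induction hT : h T using EReal.rec with
  | bot => exact absurd hT (hh.1 T)
  | top => exact le_top
  | coe b =>
    rw [hT, ← EReal.coe_add, ← EReal.coe_add, EReal.coe_le_coe_iff] at h1
    rw [EReal.coe_le_coe_iff]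
    linarith

theorem half_mul_norm_sub_sq_sub (a : ℝ) (T u y : V) :
    a / 2 * ‖T - y‖ ^ 2 - a / 2 * ‖u - y‖ ^ 2 =
      inner ℝ (a • (u - y)) (T - u) + a / 2 * ‖T - u‖ ^ 2 := by
  have h : T - y = (u - y) + (T - u) := by abel
  rw [h, norm_add_sq_real, inner_smul_left]
  simp
  ring

/-- The quadratic expansion of `x ↦ (α / 2) ‖L x - Z‖²`. -/
theorem half_mul_norm_map_sub_sq_sub [CompleteSpace V] [CompleteSpace G] (α : ℝ) (L : V →L[ℝ] G)
    (Z : G) (w v : V) :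
    α / 2 * ‖L (w + v) - Z‖ ^ 2 - α / 2 * ‖L w - Z‖ ^ 2 =
      inner ℝ (α • ContinuousLinearMap.adjoint L (L w - Z)) v + α / 2 * ‖L v‖ ^ 2 := by
  have h : L (w + v) - Z = (L w - Z) + L v := by rw [map_add]; abel
  rw [h, norm_add_sq_real, inner_smul_left, ContinuousLinearMap.adjoint_inner_left]
  simp
  ring

theorem hasGradientAt_half_mul_norm_map_sub_sq [CompleteSpace V] [CompleteSpace G] (α : ℝ)
    (L : V →L[ℝ] G) (Z : G) (x : V) :
    HasGradientAt (fun T => α / 2 * ‖L T - Z‖ ^ 2)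
      (α • ContinuousLinearMap.adjoint L (L x - Z)) x := by
  rw [hasGradientAt_iff_hasFDerivAt]
  have h1 := ((L.hasFDerivAt (x := x)).sub_const Z).norm_sq.const_mul (α / 2)
  refine h1.congr_fderiv ?_
  ext v
  simp [ContinuousLinearMap.adjoint_inner_left]
  ring

/-- Absolute values are used because α may be negative. -/
theorem sq_norm_map_le (α : ℝ) (L : V →L[ℝ] G) (v : V) :
    α / 2 * ‖L v‖ ^ 2 ≤ |α| * ‖L‖ ^ 2 * ‖v‖ ^ 2 := by
  have h1 : ‖L v‖ ^ 2 ≤ ‖L‖ ^ 2 * ‖v‖ ^ 2 := by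
    rw [← mul_pow]
    gcongr
    exact L.le_opNorm v
  calc α / 2 * ‖L v‖ ^ 2 ≤ |α| * ‖L v‖ ^ 2 := by
        gcongr
        linarith [le_abs_self α, abs_nonneg α]
    _ ≤ |α| * (‖L‖ ^ 2 * ‖v‖ ^ 2) := by gcongr
    _ = _ := by ring

/-- Minimizers of `h` plus a coupling term plus two quadratic penalties. -/
theorem quadMinorant_of_coupling {h : V → EReal} (hh : ProperFun h) {g : V → ℝ} {lam μ K : ℝ}
    {x y u e : V}
    (hu : IsMinOn (fun T => h T +
      ((g T + lam / 2 * ‖T - y‖ ^ 2 + μ / 2 * ‖T - x‖ ^ 2 : ℝ) : EReal)) Set.univ u)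
    (hg : ∀ T, g T - g u ≤ inner ℝ e (T - u) + K * ‖T - u‖ ^ 2) :
    QuadMinorant h (K + |lam| + |μ|) u (e + lam • (u - y) + μ • (u - x)) := by
  refine quadMinorant_of_isMinOn hh hu fun T => ?_
  have h1 := half_mul_norm_sub_sq_sub lam T u y
  have h2 := half_mul_norm_sub_sq_sub μ T u x
  have h3 := hg T
  have h4 : lam / 2 * ‖T - u‖ ^ 2 ≤ |lam| * ‖T - u‖ ^ 2 := by
    gcongr
    linarith [le_abs_self lam, abs_nonneg lam]
  have h5 : μ / 2 * ‖T - u‖ ^ 2 ≤ |μ| * ‖T - u‖ ^ 2 := by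
    gcongr
    linarith [le_abs_self μ, abs_nonneg μ]
  rw [inner_add_left, inner_add_left, add_mul, add_mul]
  linarith

end QuadMinorant

/-! ### Column projections for the hierarchical scheme -/

section Columns

variable {n r : ℕ}

/-- The matrix that keeps the `i`-th column and has zeros elsewhere. -/
def colProj (i : Fin r) : Mat n r →L[ℝ] Mat n r :=
  LinearMap.toContinuousLinearMap
    { toFun := fun T => WithLp.toLp 2 fun p => if p.2 = i then T p else 0
      map_add' := fun S T => by ext p; by_cases hp : p.2 = i <;> simp [hp]
      map_smul' := fun a T => by ext p; by_cases hp : p.2 = i <;> simp [hp] }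

theorem colProj_apply (i : Fin r) (T : Mat n r) (p : Fin n × Fin r) :
    colProj i T p = if p.2 = i then T p else 0 := rfl

theorem sum_colProj (T : Mat n r) : ∑ i, colProj i T = T := by
  ext p
  simp [colProj_apply]

/-- The mixed matrix is affine in its free column, with linear part `colProj i`, so each column
subproblem is again a linear least-squares coupling. -/
theorem mixCols_col (U T X : Mat n r) (i : Fin r) :
    mixCols U i (col T i) X = mixCols U i (col U i) X + colProj i (T - U) := by
  ext p
  obtain ⟨a, j⟩ := p
  rcases lt_trichotomy j i with h | h | h
  · simp [mixCols, colProj_apply, h, h.ne]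
  · subst h
    simp [mixCols, colProj_apply, col]
  · simp [mixCols, colProj_apply, h.ne', h.not_gt]

theorem norm_mixCols_sub_le (U X : Mat n r) (i : Fin r) :
    ‖mixCols U i (col U i) X - X‖ ≤ ‖U - X‖ := by
  rw [EuclideanSpace.norm_eq, EuclideanSpace.norm_eq]
  refine Real.sqrt_le_sqrt (Finset.sum_le_sum fun p _ => ?_)
  obtain ⟨a, j⟩ := p
  rcases lt_trichotomy j i with h | h | h
  · simp [mixCols, h]
  · subst h
    simp [mixCols, col]
  · simp [mixCols, h.ne', h.not_gt, sq_nonneg]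

theorem sum_norm_col_sub_sq (T Y : Mat n r) : ∑ i, ‖col T i - col Y i‖ ^ 2 = ‖T - Y‖ ^ 2 := by
  simp only [EuclideanSpace.norm_sq_eq, Fintype.sum_prod_type]
  rw [Finset.sum_comm]
  rfl

/-- A constant that bounds the number of columns and the norms of their projections. -/
def colConst (n r : ℕ) : ℝ :=
  1 + ∑ i : Fin r, (‖(colProj i : Mat n r →L[ℝ] Mat n r)‖ ^ 2 +
    ‖(colProj i : Mat n r →L[ℝ] Mat n r)‖)

theorem one_le_colConst : 1 ≤ colConst n r :=
  le_add_of_nonneg_right (Finset.sum_nonneg fun _ _ => by positivity)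

theorem sum_norm_sq_le_colConst :
    ∑ i : Fin r, ‖(colProj i : Mat n r →L[ℝ] Mat n r)‖ ^ 2 ≤ colConst n r := by
  rw [colConst, Finset.sum_add_distrib]
  have : 0 ≤ ∑ i : Fin r, ‖(colProj i : Mat n r →L[ℝ] Mat n r)‖ :=
    Finset.sum_nonneg fun _ _ => norm_nonneg _
  linarith

theorem sum_norm_le_colConst :
    ∑ i : Fin r, ‖(colProj i : Mat n r →L[ℝ] Mat n r)‖ ≤ colConst n r := by
  rw [colConst, Finset.sum_add_distrib]
  have : 0 ≤ ∑ i : Fin r, ‖(colProj i : Mat n r →L[ℝ] Mat n r)‖ ^ 2 :=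
    Finset.sum_nonneg fun _ _ => by positivity
  linarith

end Columns

/-! ### One block update, in each of the three schemes -/

section BlockUpdate

variable {n r : ℕ} {G : Type*} [NormedAddCommGroup G] [InnerProductSpace ℝ G] [CompleteSpace G]
  {h : Mat n r → EReal} {α lam μ : ℝ} {L : Mat n r →L[ℝ] G} {Z : G} {x y u : Mat n r}

theorem norm_adjoint_map_le (L : Mat n r →L[ℝ] G) (v : Mat n r) :
    ‖ContinuousLinearMap.adjoint L (L v)‖ ≤ ‖L‖ ^ 2 * ‖v‖ := by
  calc ‖ContinuousLinearMap.adjoint L (L v)‖ ≤ ‖ContinuousLinearMap.adjoint L‖ * ‖L v‖ :=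
        ContinuousLinearMap.le_opNorm _ _
    _ ≤ ‖L‖ * (‖L‖ * ‖v‖) := by
        rw [LinearIsometryEquiv.norm_map]
        gcongr
        exact L.le_opNorm v
    _ = _ := by ring

/-- `e` is the gradient of the smooth part at `(x, y)`, shifted to the new point `u`, up to an error
controlled by the step length. -/
def NearGradient (α lam μ : ℝ) (L : Mat n r →L[ℝ] G) (Z : G) (x y u e : Mat n r) : Prop :=
  ‖e - (α • ContinuousLinearMap.adjoint L (L x - Z) + lam • (u - y))‖ ≤
    (|α| * ‖L‖ ^ 2 * colConst n r + |μ|) * ‖u - x‖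

theorem exists_quadMinorant_of_prox (hh : ProperFun h)
    (hu : IsMinOn (fun T => h T + ((α / 2 * ‖L T - Z‖ ^ 2 + lam / 2 * ‖T - y‖ ^ 2 +
      μ / 2 * ‖T - x‖ ^ 2 : ℝ) : EReal)) Set.univ u) :
    ∃ e, QuadMinorant h (|α| * ‖L‖ ^ 2 * colConst n r + |lam| + |μ|) u e ∧
      NearGradient α lam μ L Z x y u e := by
  have hc := one_le_colConst (n := n) (r := r)
  have hc' : |α| * ‖L‖ ^ 2 ≤ |α| * ‖L‖ ^ 2 * colConst n r :=
    le_mul_of_one_le_right (by positivity) hc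
  refine ⟨_, (quadMinorant_of_coupling hh hu (K := |α| * ‖L‖ ^ 2)
    (e := α • ContinuousLinearMap.adjoint L (L u - Z)) fun T => ?_).mono (by gcongr), ?_⟩
  · have h1 := half_mul_norm_map_sub_sq_sub α L Z u (T - u)
    rw [add_sub_cancel] at h1
    rw [h1]
    exact add_le_add_right (sq_norm_map_le α L _) _
  · have h1 : α • ContinuousLinearMap.adjoint L (L u - Z) + lam • (u - y) + μ • (u - x) -
        (α • ContinuousLinearMap.adjoint L (L x - Z) + lam • (u - y)) =
        α • ContinuousLinearMap.adjoint L (L (u - x)) + μ • (u - x) := by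
      simp only [map_sub, smul_sub]
      abel
    rw [NearGradient, h1]
    refine (norm_add_le _ _).trans ?_
    rw [norm_smul, norm_smul, Real.norm_eq_abs, Real.norm_eq_abs, add_mul]
    refine add_le_add_left ((mul_le_mul_of_nonneg_left (norm_adjoint_map_le L _)
      (abs_nonneg α)).trans ?_) _
    rw [← mul_assoc]
    gcongr

theorem exists_quadMinorant_of_proxLinear (hh : ProperFun h)
    (hu : IsMinOn (fun T => h T +
      ((inner ℝ (gradient (fun T' => α / 2 * ‖L T' - Z‖ ^ 2) x) (T - x) +
        lam / 2 * ‖T - y‖ ^ 2 + μ / 2 * ‖T - x‖ ^ 2 : ℝ) : EReal)) Set.univ u) :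
    ∃ e, QuadMinorant h (|α| * ‖L‖ ^ 2 * colConst n r + |lam| + |μ|) u e ∧
      NearGradient α lam μ L Z x y u e := by
  have hc := one_le_colConst (n := n) (r := r)
  rw [(hasGradientAt_half_mul_norm_map_sub_sq α L Z x).gradient] at hu
  refine ⟨_, (quadMinorant_of_coupling hh hu (K := 0)
    (e := α • ContinuousLinearMap.adjoint L (L x - Z)) fun T => ?_).mono ?_, ?_⟩
  · rw [← inner_sub_right]
    simp
  · gcongr
    positivity
  · rw [NearGradient, add_sub_cancel_left, norm_smul, Real.norm_eq_abs]
    gcongr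
    exact le_add_of_nonneg_left (by positivity)

/-- Once u is fixed, the i-th coupling depends only on the i-th column of the competitor. Adding the
column inequalities therefore makes u a minimizer of a single separable surrogate, whose gradient at
u collects the partial gradients at the mixed matrices m i, each within ‖u - x‖ of x. -/
theorem exists_quadMinorant_of_hierarchical (hh : ProperFun h)
    {ψ : Fin r → EuclideanSpace ℝ (Fin n) → EReal} (hψ : ∀ T, h T = ∑ i, ψ i (col T i))
    (hu : ∀ i, IsMinOn (fun t => ψ i t + ((α / 2 * ‖L (mixCols u i t x) - Z‖ ^ 2 +
      lam / 2 * ‖t - col y i‖ ^ 2 + μ / 2 * ‖t - col x i‖ ^ 2 : ℝ) : EReal))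
      Set.univ (col u i)) :
    ∃ e, QuadMinorant h (|α| * ‖L‖ ^ 2 * colConst n r + |lam| + |μ|) u e ∧
      NearGradient α lam μ L Z x y u e := by
  set m : Fin r → Mat n r := fun i => mixCols u i (col u i) x with hm
  have hmin : IsMinOn (fun T => h T + (((∑ i, α / 2 * ‖L (mixCols u i (col T i) x) - Z‖ ^ 2) +
      lam / 2 * ‖T - y‖ ^ 2 + μ / 2 * ‖T - x‖ ^ 2 : ℝ) : EReal)) Set.univ u := by
    intro T _
    have hi : ∀ i ∈ Finset.univ, ψ i (col u i) +
        ((α / 2 * ‖L (mixCols u i (col u i) x) - Z‖ ^ 2 + lam / 2 * ‖col u i - col y i‖ ^ 2 +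
          μ / 2 * ‖col u i - col x i‖ ^ 2 : ℝ) : EReal) ≤ ψ i (col T i) +
        ((α / 2 * ‖L (mixCols u i (col T i) x) - Z‖ ^ 2 + lam / 2 * ‖col T i - col y i‖ ^ 2 +
          μ / 2 * ‖col T i - col x i‖ ^ 2 : ℝ) : EReal) :=
      fun i _ => hu i (Set.mem_univ (col T i))
    have hsum := Finset.sum_le_sum hi
    simpa only [Set.mem_ofPred_eq, Finset.sum_add_distrib, ← coe_sum_ereal, ← Finset.mul_sum,
      sum_norm_col_sub_sq, ← hψ] using hsum
  refine ⟨_, (quadMinorant_of_coupling hh hmin (K := |α| * ‖L‖ ^ 2 * colConst n r)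
    (e := ∑ i, ContinuousLinearMap.adjoint (colProj i)
      (α • ContinuousLinearMap.adjoint L (L (m i) - Z))) fun T => ?_), ?_⟩
  · rw [← Finset.sum_sub_distrib, sum_inner]
    have hle : ∀ i ∈ Finset.univ, α / 2 * ‖L (mixCols u i (col T i) x) - Z‖ ^ 2 -
        α / 2 * ‖L (mixCols u i (col u i) x) - Z‖ ^ 2 ≤
        inner ℝ (ContinuousLinearMap.adjoint (colProj i)
          (α • ContinuousLinearMap.adjoint L (L (m i) - Z))) (T - u) +
        |α| * ‖L‖ ^ 2 * ‖(colProj i : Mat n r →L[ℝ] Mat n r)‖ ^ 2 * ‖T - u‖ ^ 2 := by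
      intro i _
      rw [mixCols_col u T x i, half_mul_norm_map_sub_sq_sub,
        ContinuousLinearMap.adjoint_inner_left]
      refine add_le_add_right ((sq_norm_map_le α L _).trans ?_) _
      rw [mul_assoc (|α| * ‖L‖ ^ 2), ← mul_pow]
      gcongr
      exact ContinuousLinearMap.le_opNorm _ _
    refine (Finset.sum_le_sum hle).trans ?_
    rw [Finset.sum_add_distrib, ← Finset.sum_mul, ← Finset.mul_sum]
    gcongr
    exact sum_norm_sq_le_colConst
  -- The projections sum to the identity, so the gradient at x splits into the same column pieces
  -- and can be subtracted term by term.
  · have hid : ∀ v : Mat n r, ∑ i, ContinuousLinearMap.adjoint (colProj i) v = v := by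
      intro v
      refine ext_inner_right ℝ fun w => ?_
      simp only [sum_inner, ContinuousLinearMap.adjoint_inner_left]
      rw [← inner_sum, sum_colProj]
    have h1 : (∑ i, ContinuousLinearMap.adjoint (colProj i)
          (α • ContinuousLinearMap.adjoint L (L (m i) - Z))) + lam • (u - y) + μ • (u - x) -
        (α • ContinuousLinearMap.adjoint L (L x - Z) + lam • (u - y)) =
        (∑ i, ContinuousLinearMap.adjoint (colProj i)
          (α • ContinuousLinearMap.adjoint L (L (m i - x)))) + μ • (u - x) := by
      rw [← hid (α • ContinuousLinearMap.adjoint L (L x - Z))]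
      simp only [map_sub, smul_sub, Finset.sum_sub_distrib]
      abel
    rw [NearGradient, h1]
    refine (norm_add_le _ _).trans ?_
    rw [norm_smul, Real.norm_eq_abs, add_mul]
    gcongr
    have h2 : ∀ i ∈ Finset.univ, ‖ContinuousLinearMap.adjoint (colProj i)
        (α • ContinuousLinearMap.adjoint L (L (m i - x)))‖ ≤
        |α| * ‖L‖ ^ 2 * ‖(colProj i : Mat n r →L[ℝ] Mat n r)‖ * ‖u - x‖ := by
      intro i _
      refine (ContinuousLinearMap.le_opNorm _ _).trans ?_
      rw [LinearIsometryEquiv.norm_map, norm_smul, Real.norm_eq_abs]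
      have h3 : ‖ContinuousLinearMap.adjoint L (L (m i - x))‖ ≤ ‖L‖ ^ 2 * ‖u - x‖ :=
        (norm_adjoint_map_le L _).trans (by gcongr; exact norm_mixCols_sub_le u x i)
      calc _ ≤ ‖(colProj i : Mat n r →L[ℝ] Mat n r)‖ * (|α| * (‖L‖ ^ 2 * ‖u - x‖)) := by gcongr
        _ = _ := by ring
    refine (norm_sum_le_of_le _ h2).trans ?_
    rw [← Finset.sum_mul, ← Finset.mul_sum]
    gcongr
    exact sum_norm_le_colConst

end BlockUpdate
end

noncomputable section

/-! ### The bilinear product, spectral norm and least-squares derivative -/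

section MatrixBilinear

variable {n r : ℕ}

/-- The product `X Yᵀ` as a continuous bilinear map. -/
def mulTBilin (n r : ℕ) : Mat n r →L[ℝ] Mat n r →L[ℝ] Mat n n :=
  (LinearMap.mk₂ ℝ mulT
    (fun X X' Y => by ext p; simp [mulT, add_mul, Finset.sum_add_distrib])
    (fun a X Y => by ext p; simp [mulT, mul_assoc, Finset.mul_sum])
    (fun X Y Y' => by ext p; simp [mulT, mul_add, Finset.sum_add_distrib])
    (fun a X Y => by
      ext p; simp [mulT, mul_left_comm, Finset.mul_sum])).toContinuousBilinearMap

theorem mulTBilin_apply (X Y : Mat n r) : mulTBilin n r X Y = mulT X Y := rfl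

theorem norm_mulT_le (X Y : Mat n r) : ‖mulT X Y‖ ≤ ‖mulTBilin n r‖ * ‖X‖ * ‖Y‖ :=
  (mulTBilin n r).le_opNorm₂ X Y

theorem norm_mulTBilin_apply_le (X : Mat n r) : ‖mulTBilin n r X‖ ≤ ‖mulTBilin n r‖ * ‖X‖ :=
  (mulTBilin n r).le_opNorm X

theorem norm_mulTBilin_flip_le (Y : Mat n r) :
    ‖(mulTBilin n r).flip Y‖ ≤ ‖mulTBilin n r‖ * ‖Y‖ := by
  simpa using (mulTBilin n r).flip.le_opNorm Y

theorem mulT_sub_mulT (U V X Y : Mat n r) :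
    mulT U V - mulT X Y = mulT U (V - Y) + mulT (U - X) Y := by
  simp only [← mulTBilin_apply, map_sub, sub_apply]
  abel

/-- The operator of a matrix, depending linearly on the matrix. -/
def toOperator (n r : ℕ) :
    Mat n r →L[ℝ] EuclideanSpace ℝ (Fin r) →L[ℝ] EuclideanSpace ℝ (Fin n) :=
  LinearMap.toContinuousLinearMap (LinearMap.toContinuousLinearMap.toLinearMap ∘ₗ
    Matrix.toEuclideanLin.toLinearMap ∘ₗ
    { toFun := fun X : Mat n r => Matrix.of fun i j => X (i, j)
      map_add' := fun _ _ => rfl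
      map_smul' := fun _ _ => rfl })

theorem specNorm_le (X : Mat n r) : specNorm X ≤ ‖toOperator n r‖ * ‖X‖ :=
  (toOperator n r).le_opNorm X

theorem specNorm_nonneg (X : Mat n r) : 0 ≤ specNorm X := norm_nonneg _

theorem adjoint_sub_adjoint_norm_le {V G : Type*} [NormedAddCommGroup V] [InnerProductSpace ℝ V]
    [CompleteSpace V] [NormedAddCommGroup G] [InnerProductSpace ℝ G] [CompleteSpace G]
    (L M : V →L[ℝ] G) (a b : G) :
    ‖ContinuousLinearMap.adjoint L a - ContinuousLinearMap.adjoint M b‖ ≤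
      ‖L - M‖ * ‖a‖ + ‖M‖ * ‖a - b‖ := by
  have h : ContinuousLinearMap.adjoint L a - ContinuousLinearMap.adjoint M b =
      ContinuousLinearMap.adjoint (L - M) a + ContinuousLinearMap.adjoint M (a - b) := by
    simp
  rw [h]
  refine (norm_add_le _ _).trans (add_le_add ?_ ?_) <;>
  · refine (ContinuousLinearMap.le_opNorm _ _).trans ?_
    rw [LinearIsometryEquiv.norm_map]

theorem hasFDerivAt_half_mul_norm_sub_sq {V G : Type*} [NormedAddCommGroup V] [NormedSpace ℝ V]
    [NormedAddCommGroup G] [InnerProductSpace ℝ G] (c : ℝ) {f : V → G} {f' : V →L[ℝ] G} {w : V}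
    (hf : HasFDerivAt f f' w) (b : G) :
    HasFDerivAt (fun w => c / 2 * ‖f w - b‖ ^ 2) (c • (innerSL ℝ (f w - b)).comp f') w := by
  refine ((hf.sub_const b).norm_sq.const_mul (c / 2)).congr_fderiv ?_
  ext v
  simp
  ring

/-- The derivative of `½ ‖A (B (f W) (g W)) - b‖² + (c / 2) ‖f W - g W‖²` for `B` bilinear. -/
theorem fderiv_bilinear_least_squares_add {V E G H : Type*} [NormedAddCommGroup V]
    [NormedSpace ℝ V] [NormedAddCommGroup E] [InnerProductSpace ℝ E] [CompleteSpace E]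
    [NormedAddCommGroup G] [InnerProductSpace ℝ G] [CompleteSpace G] [NormedAddCommGroup H]
    [InnerProductSpace ℝ H] [CompleteSpace H] (B : E →L[ℝ] E →L[ℝ] G) (A : G →L[ℝ] H) (b : H)
    (c : ℝ) (f g : V →L[ℝ] E) (W v : V) :
    fderiv ℝ (fun W => 1 / 2 * ‖A (B (f W) (g W)) - b‖ ^ 2 + c / 2 * ‖f W - g W‖ ^ 2) W v =
      inner ℝ (ContinuousLinearMap.adjoint (B.flip (g W))
        (ContinuousLinearMap.adjoint A (A (B (f W) (g W)) - b)) + c • (f W - g W)) (f v) +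
      inner ℝ (ContinuousLinearMap.adjoint (B (f W))
        (ContinuousLinearMap.adjoint A (A (B (f W) (g W)) - b)) + c • (g W - f W)) (g v) := by
  have h1 := hasFDerivAt_half_mul_norm_sub_sq 1
    (A.hasFDerivAt.comp W (B.hasFDerivAt_of_bilinear (f.hasFDerivAt (x := W)) g.hasFDerivAt)) b
  have h2 := hasFDerivAt_half_mul_norm_sub_sq c ((f - g).hasFDerivAt (x := W)) 0
  have h3 := h1.add h2
  simp only [sub_zero, Function.comp_apply] at h3
  have h4 := congrArg (fun L : V →L[ℝ] ℝ => L v) h3.fderiv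
  refine Eq.trans h4 ?_
  rw [← neg_sub (f W) (g W), smul_neg]
  simp only [ContinuousLinearMap.adjoint_inner_left, inner_add_left,
    inner_sub_right, real_inner_smul_left, inner_neg_left, add_apply, smul_apply,
    ContinuousLinearMap.comp_apply, innerSL_apply_apply, smul_eq_mul, sub_apply, map_add,
    ContinuousLinearMap.precompR_apply, ContinuousLinearMap.precompL_apply,
    ContinuousLinearMap.flip_apply]
  change 1 * (inner ℝ _ (A (B (f W) (g v))) + _) + _ = _
  ring

end MatrixBilinear

/-! ### The objective: smooth part, semicontinuity and minorants -/

namespace GSMF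

variable {n r q : ℕ} (P : GSMF n r q) (S : ANAUMParams)

/-- The smooth part of the objective. -/
def smooth (W : MatPair n r) : ℝ :=
  1 / 2 * ‖P.A (mulT W.fst W.snd) - P.b‖ ^ 2 + P.lam / 2 * ‖W.fst - W.snd‖ ^ 2

/-- The gradient of `M ↦ ½ ‖A M - b‖²` at `M = X Yᵀ`. -/
def residual (X Y : Mat n r) : Mat n n :=
  ContinuousLinearMap.adjoint P.A (P.A (mulT X Y) - P.b)

theorem objective_eq (W : MatPair n r) :
    P.objective W = P.Ψ W.fst + P.Φ W.snd + (P.smooth W : EReal) := rfl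

theorem contDiff_smooth : ContDiff ℝ 1 P.smooth := by
  have h1 := (WithLp.fstL 2 ℝ (Mat n r) (Mat n r)).contDiff (n := 1)
  have h2 := (WithLp.sndL 2 ℝ (Mat n r) (Mat n r)).contDiff (n := 1)
  have h3 : ContDiff ℝ 1 (fun W : MatPair n r => mulT W.fst W.snd) :=
    (mulTBilin n r).isBoundedBilinearMap.contDiff.comp (h1.prodMk h2)
  have h4 := (((P.A.contDiff (n := 1)).comp h3).sub (contDiff_const (c := P.b))).norm_sq ℝ
  have h5 := (h1.sub h2).norm_sq ℝ
  exact (contDiff_const.mul h4).add (contDiff_const.mul h5)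

theorem fderiv_smooth (W V : MatPair n r) :
    fderiv ℝ P.smooth W V =
      inner ℝ (ContinuousLinearMap.adjoint ((mulTBilin n r).flip W.snd) (P.residual W.fst W.snd) +
        P.lam • (W.fst - W.snd)) V.fst +
      inner ℝ (ContinuousLinearMap.adjoint (mulTBilin n r W.fst) (P.residual W.fst W.snd) +
        P.lam • (W.snd - W.fst)) V.snd := by
  exact fderiv_bilinear_least_squares_add (mulTBilin n r) P.A P.b P.lam
    (WithLp.fstL 2 ℝ (Mat n r) (Mat n r)) (WithLp.sndL 2 ℝ (Mat n r) (Mat n r)) W V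

section Objective

variable {P}

theorem objective_ne_bot (hΨ : ProperFun P.Ψ) (hΦ : ProperFun P.Φ) (W : MatPair n r) :
    P.objective W ≠ ⊥ := by
  simp [objective_eq, EReal.add_eq_bot_iff, hΨ.1, hΦ.1]

theorem lowerSemicontinuous_objective (hΨ : ProperClosedBddBelow P.Ψ)
    (hΦ : ProperClosedBddBelow P.Φ) : LowerSemicontinuous P.objective := by
  have h1 : LowerSemicontinuous fun W : MatPair n r => P.Ψ W.fst :=
    hΨ.2.1.comp (WithLp.fstL 2 ℝ (Mat n r) (Mat n r)).continuous
  have h2 : LowerSemicontinuous fun W : MatPair n r => P.Φ W.snd :=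
    hΦ.2.1.comp (WithLp.sndL 2 ℝ (Mat n r) (Mat n r)).continuous
  have h3 : LowerSemicontinuous fun W : MatPair n r => (P.smooth W : EReal) :=
    (continuous_coe_real_ereal.comp P.contDiff_smooth.continuous).lowerSemicontinuous
  exact (h1.add' h2 fun W => EReal.continuousAt_add (Or.inr (hΦ.1.1 _)) (Or.inl (hΨ.1.1 _))).add'
    h3 fun W => EReal.continuousAt_add (Or.inr (EReal.coe_ne_bot _)) (Or.inr (EReal.coe_ne_top _))

theorem bddBelowFun_objective (hlam : 0 ≤ P.lam) (hΨ : BddBelowFun P.Ψ) (hΦ : BddBelowFun P.Φ) :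
    BddBelowFun P.objective := by
  obtain ⟨a, ha⟩ := hΨ
  obtain ⟨b, hb⟩ := hΦ
  refine ⟨a + b + 0, fun W => ?_⟩
  rw [objective_eq, EReal.coe_add, EReal.coe_add]
  refine add_le_add (add_le_add (ha _) (hb _)) ?_
  rw [EReal.coe_le_coe_iff, smooth]
  positivity

/-- The bounds for the two regularizers add up, while the smooth part is carried exactly:
subtracting its differential and restoring it inside the subgradient needs no estimate. -/
theorem isMinorant_objective {U V e₁ e₂ : Mat n r} {K a : ℝ} (h₁ : QuadMinorant P.Ψ K U e₁)
    (h₂ : QuadMinorant P.Φ K V e₂) (ha : P.F U V = a) :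
    IsMinorant P.objective P.smooth K a (WithLp.toLp 2 (U, V)) (WithLp.toLp 2
      (ContinuousLinearMap.adjoint ((mulTBilin n r).flip V) (P.residual U V) +
        P.lam • (U - V) - e₁,
      ContinuousLinearMap.adjoint (mulTBilin n r U) (P.residual U V) + P.lam • (V - U) - e₂)) := by
  obtain ⟨a₁, ha₁, h₁⟩ := h₁
  obtain ⟨a₂, ha₂, h₂⟩ := h₂
  have haa : a = a₁ + a₂ + P.smooth (WithLp.toLp 2 (U, V)) := by
    have h : P.F U V = P.Ψ U + P.Φ V + (P.smooth (WithLp.toLp 2 (U, V)) : EReal) := rfl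
    rw [ha, ha₁, ha₂, ← EReal.coe_add, ← EReal.coe_add, EReal.coe_eq_coe_iff] at h
    exact h
  intro W
  have hfd : fderiv ℝ P.smooth (WithLp.toLp 2 (U, V)) (W - WithLp.toLp 2 (U, V)) =
      inner ℝ (ContinuousLinearMap.adjoint ((mulTBilin n r).flip V) (P.residual U V) +
        P.lam • (U - V)) (W.fst - U) +
      inner ℝ (ContinuousLinearMap.adjoint (mulTBilin n r U) (P.residual U V) +
        P.lam • (V - U)) (W.snd - V) := P.fderiv_smooth _ _
  refine le_trans ?_ (add_le_add (add_le_add (h₁ W.fst) (h₂ W.snd)) (le_refl (P.smooth W : EReal)))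
  rw [← EReal.coe_add, ← EReal.coe_add, EReal.coe_le_coe_iff, hfd,
    WithLp.prod_inner_apply, WithLp.prod_norm_sq_eq_of_L2, haa]
  change _ + (inner ℝ (_ - e₁) (W.fst - U) + inner ℝ (_ - e₂) (W.snd - V)) -
    K * (‖W.fst - U‖ ^ 2 + ‖W.snd - V‖ ^ 2) ≤ _
  rw [inner_sub_left, inner_sub_left]
  linarith

end Objective

/-! ### Parameter identities and boundedness of the line-search parameters -/

section Cap

variable {P S}

theorem Admissible.add_eq_mul (hS : P.Admissible S) : S.α + S.β = S.α * S.β := by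
  have h := hS.inv_add_inv
  have h1 := hS.α_ne
  have h2 := hS.β_ne
  field_simp at h
  linarith

theorem Admissible.beta_div (hS : P.Admissible S) : S.β / (S.α + S.β) = 1 / S.α := by
  have h1 := hS.α_ne
  have h2 := hS.β_ne
  rw [hS.add_eq_mul]
  field_simp

/-- Since β / (α + β) = 1 / α, the choice of Z makes the gradients of the coupling and of the data
term agree at the current iterate. -/
theorem Admissible.smul_sub_Zof (hS : P.Admissible S) (X Y : Mat n r) :
    S.α • (mulT X Y - P.Zof S X Y) = P.residual X Y := by
  have h1 := hS.α_ne
  rw [Zof, hS.beta_div, residual]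
  simp only [AstarA, sub_apply, ContinuousLinearMap.id_apply, smul_apply,
    ContinuousLinearMap.comp_apply, map_sub, smul_sub, smul_add, smul_smul, mul_one_div_cancel h1,
    one_smul]
  abel

theorem rho_nonneg : 0 ≤ P.rho S := sq_nonneg _

theorem sq_le_rho {t : ℝ} {v : Mat n n} (hv : v ≠ 0)
    (h : (ContinuousLinearMap.id ℝ (Mat n n) - (S.β / (S.α + S.β)) • P.AstarA) v = t • v) :
    t ^ 2 ≤ P.rho S := by
  have h1 := (ContinuousLinearMap.id ℝ (Mat n n) - (S.β / (S.α + S.β)) • P.AstarA).le_opNorm v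
  rw [h, norm_smul] at h1
  rw [rho, ← sq_abs]
  have := le_of_mul_le_mul_right h1 (norm_pos_iff.2 hv)
  rw [Real.norm_eq_abs] at this
  gcongr

theorem Admissible.add_mul_nonneg_of_eigen (hS : P.Admissible S) {t : ℝ} {v : Mat n n}
    (hv : v ≠ 0) (h : P.AstarA v = t • v) : 0 ≤ S.α + S.γ + S.β * t := by
  have h1 := hS.γ_psd.inner_nonneg_left v
  simp only [add_apply, smul_apply, ContinuousLinearMap.id_apply, h, smul_smul,
    ← add_smul, inner_smul_left, real_inner_self_eq_norm_sq] at h1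
  have h2 : 0 < ‖v‖ ^ 2 := by
    have := norm_pos_iff.2 hv
    positivity
  exact nonneg_of_mul_nonneg_left (by simpa using h1) h2

/-- Only α < 0 needs an argument. As A A* = I, the map A*A is a projection. If it fixes M,
positivity gives γ ≥ -αβ and ρ ≥ (1 - 1/α)², hence γρ ≥ 1 - α and the coefficient is at least 2 - α.
Otherwise M - A*A M is a nonzero kernel vector, giving γ ≥ -α and ρ ≥ 1. -/
theorem Admissible.coeff_nonneg (hS : P.Admissible S)
    (hA : P.A ∘L ContinuousLinearMap.adjoint P.A =
      ContinuousLinearMap.id ℝ (EuclideanSpace ℝ (Fin q))) {M : Mat n n} (hM : M ≠ 0) :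
    0 ≤ S.α + 2 * S.γ * P.rho S := by
  have hγ := hS.γ_nonneg
  have hρ := P.rho_nonneg (S := S)
  rcases lt_or_gt_of_ne hS.α_ne with hα | hα
  swap
  · positivity
  by_cases hv : M - P.AstarA M = 0
  · have h1 : P.AstarA M = (1 : ℝ) • M := by rw [one_smul]; exact (sub_eq_zero.1 hv).symm
    have h2 := hS.add_mul_nonneg_of_eigen hM h1
    have h3 : (1 - 1 / S.α) ^ 2 ≤ P.rho S := by
      refine sq_le_rho hM ?_
      rw [hS.beta_div]
      simp [h1, sub_smul]
    have h4 := hS.add_eq_mul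
    have h5 : -(S.α * S.β) ≤ S.γ := by linarith
    have h6 : S.γ * (1 - 1 / S.α) ^ 2 ≤ S.γ * P.rho S := by gcongr
    have h7 : -(S.α * S.β) * (1 - 1 / S.α) ^ 2 ≤ S.γ * (1 - 1 / S.α) ^ 2 := by gcongr
    have h8 : -(S.α * S.β) * (1 - 1 / S.α) ^ 2 = 1 - S.α := by
      have h9 : S.β * (S.α - 1) = S.α := by linarith
      have h10 := hS.α_ne
      have h11 : 1 - 1 / S.α = (S.α - 1) / S.α := by field_simp
      rw [h11, div_pow, mul_div_assoc', div_eq_iff (by positivity)]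
      calc -(S.α * S.β) * (S.α - 1) ^ 2 = -S.α * (S.α - 1) * (S.β * (S.α - 1)) := by ring
        _ = (1 - S.α) * S.α ^ 2 := by rw [h9]; ring
    linarith
  · have h1 : P.AstarA (M - P.AstarA M) = (0 : ℝ) • (M - P.AstarA M) := by
      have h := congrArg (fun T => ContinuousLinearMap.adjoint P.A (T (P.A M))) hA
      simp only [ContinuousLinearMap.comp_apply, ContinuousLinearMap.id_apply] at h
      simp [AstarA, h]
    have h2 := hS.add_mul_nonneg_of_eigen hv h1
    have h3 : (1 : ℝ) ^ 2 ≤ P.rho S := by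
      refine sq_le_rho hv ?_
      rw [sub_apply, smul_apply, h1]
      simp
    nlinarith

theorem Admissible.cap_pos (hS : P.Admissible S)
    (hA : P.A ∘L ContinuousLinearMap.adjoint P.A =
      ContinuousLinearMap.id ℝ (EuclideanSpace ℝ (Fin q))) (W : Mat n r) : 0 < P.cap S W := by
  have hc := hS.c_pos
  have h : 0 ≤ (S.α + 2 * S.γ * P.rho S) * specNorm W ^ 2 := by
    by_cases hW : W = 0
    · have : specNorm W = 0 := le_antisymm (by simpa [hW] using specNorm_le W) (specNorm_nonneg W)
      simp [this]
    -- A nonzero W has an entry, so the space of n × n matrices is nontrivial and supplies the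
    -- nonzero M required by `Admissible.coeff_nonneg`.
    · obtain ⟨p, -⟩ : ∃ p, W p ≠ 0 := by
        by_contra! h0
        exact hW (by ext p; exact h0 p)
      have hM : (EuclideanSpace.single (p.1, p.1) 1 : Mat n n) ≠ 0 := by simp
      have := hS.coeff_nonneg hA hM
      positivity
  rw [cap]
  linarith

theorem cap_le {m : ℝ} {W : Mat n r} (hW : ‖W‖ ≤ m) :
    P.cap S W ≤ |S.α + 2 * S.γ * P.rho S| * (‖toOperator n r‖ * m) ^ 2 + S.c := by
  rw [cap]
  gcongr
  · exact le_abs_self _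
  · exact specNorm_nonneg W
  · exact (specNorm_le W).trans (by gcongr)

/-- While μ is below its cap both parameters grow by the same factor τ, so σ / μ ≤ σ_max / μ_min
persists. The raise that brings μ to its cap multiplies σ by at most τ, and later raises of σ are
capped through U. Positivity of the caps keeps both parameters positive. -/
theorem Trial.updates_and_bounds (hS : P.Admissible S) (hcap : ∀ W : Mat n r, 0 < P.cap S W)
    {X Y : Mat n r} {R μ₀ σ₀ : ℝ} (hμ₀ : S.μmin ≤ μ₀) (hσ₀ : S.σmin ≤ σ₀) (hσ₀' : σ₀ ≤ S.σmax)
    {μ σ : ℝ} {U V : Mat n r} (h : P.Trial S X Y R μ₀ σ₀ μ σ U V) :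
    P.UpdateX S X Y μ U ∧ P.UpdateY S X Y U σ V ∧ 0 < μ ∧ μ ≤ P.cap S Y ∧ 0 < σ ∧
      (μ ≠ P.cap S Y → σ * S.μmin ≤ S.σmax * μ) ∧
      (σ ≤ S.σmax ∨ σ * S.μmin ≤ S.τ * S.σmax * P.cap S Y ∨ σ ≤ P.cap S U) := by
  have hμ := hS.μmin_pos
  have hσ := hS.σmin_pos
  have hσ' := hS.σmin_lt
  have hτ := hS.τ_gt
  induction h with
  | init hU hV =>
    refine ⟨hU, hV, lt_min (by linarith) (hcap Y), min_le_right _ _, by linarith, fun hne => ?_,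
      Or.inl hσ₀'⟩
    rcases min_choice μ₀ (P.cap S Y) with h | h
    · rw [h]
      nlinarith
    · exact absurd h hne
  | @raiseSecond μ σ U V V' prev fail atCap hV ih =>
    obtain ⟨h1, h2, h3, h4, h5, h6, h7⟩ := ih
    exact ⟨h1, hV, h3, h4, lt_min (by nlinarith) (hcap U), fun hne => absurd atCap hne,
      Or.inr (Or.inr (min_le_right _ _))⟩
  | @raiseBoth μ σ U V U' V' prev fail belowCap hU hV ih =>
    obtain ⟨h1, h2, h3, h4, h5, h6, h7⟩ := ih
    have h8 := h6 belowCap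
    refine ⟨hU, hV, lt_min (by nlinarith) (hcap Y), min_le_right _ _, by nlinarith, fun hne => ?_,
      Or.inr (Or.inl ?_)⟩
    · rcases min_choice (S.τ * μ) (P.cap S Y) with h | h
      · rw [h]
        nlinarith
      · exact absurd h hne
    · calc S.τ * σ * S.μmin = S.τ * (σ * S.μmin) := by ring
        _ ≤ S.τ * (S.σmax * P.cap S Y) := by
          have : S.σmax * μ ≤ S.σmax * P.cap S Y :=
            mul_le_mul_of_nonneg_left h4 (by linarith)
          exact mul_le_mul_of_nonneg_left (h8.trans this) (by linarith)
        _ = _ := by ring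

/-- The proximal parameters of a bounded iteration are bounded. -/
theorem exists_parameter_bound (hS : P.Admissible S) (hcap : ∀ W : Mat n r, 0 < P.cap S W)
    (m : ℝ) : ∃ B : ℝ, ∀ (X Y U V : Mat n r) (R μ₀ σ₀ μ σ : ℝ), ‖Y‖ ≤ m → ‖U‖ ≤ m →
      S.μmin ≤ μ₀ → S.σmin ≤ σ₀ → σ₀ ≤ S.σmax → P.Trial S X Y R μ₀ σ₀ μ σ U V →
      P.UpdateX S X Y μ U ∧ P.UpdateY S X Y U σ V ∧ |μ| ≤ B ∧ |σ| ≤ B := by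
  set k : ℝ := |S.α + 2 * S.γ * P.rho S| * (‖toOperator n r‖ * m) ^ 2 + S.c with hk
  have hμ := hS.μmin_pos
  have hσ := hS.σmin_pos
  have hσ' := hS.σmin_lt
  have hτ := hS.τ_gt
  have hσm : 0 < S.σmax := by linarith
  refine ⟨k + S.σmax + S.τ * S.σmax * k / S.μmin, fun X Y U V R μ₀ σ₀ μ σ hY hU h1 h2 h3 hT => ?_⟩
  obtain ⟨hX, hV, hμ0, hμc, hσ0, -, hσc⟩ := hT.updates_and_bounds hS hcap h1 h2 h3
  have hcY : P.cap S Y ≤ k := cap_le hY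
  have hcU : P.cap S U ≤ k := cap_le hU
  have hk0 : 0 < k := (hcap Y).trans_le hcY
  have h4 : 0 < S.τ * S.σmax * k / S.μmin := by positivity
  refine ⟨hX, hV, ?_, ?_⟩
  · rw [abs_of_pos hμ0]
    linarith
  · rw [abs_of_pos hσ0]
    rcases hσc with h | h | h
    · linarith
    · have : σ ≤ S.τ * S.σmax * k / S.μmin := by
        rw [le_div_iff₀ hμ]
        refine h.trans ?_
        gcongr
      linarith
    · linarith

end Cap

/-! ### From block updates to a small subgradient of the objective -/

section Updates

variable {P S}

/-- With Y fixed the coupling is linear least squares for the map T ↦ T Yᵀ, so the three block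
lemmas apply verbatim. -/
theorem UpdateX.exists_quadMinorant (hΨ : ProperFun P.Ψ) {X Y U : Mat n r} {μ : ℝ}
    (h : P.UpdateX S X Y μ U) :
    ∃ e, QuadMinorant P.Ψ
        (|S.α| * ‖(mulTBilin n r).flip Y‖ ^ 2 * colConst n r + |P.lam| + |μ|) U e ∧
      NearGradient S.α P.lam μ ((mulTBilin n r).flip Y) (P.Zof S X Y) X Y U e := by
  rcases h with h | h | ⟨ψ, -, hsum, h⟩
  · exact exists_quadMinorant_of_prox hΨ h
  · exact exists_quadMinorant_of_proxLinear hΨ h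
  · exact exists_quadMinorant_of_hierarchical hΨ hsum h

theorem UpdateY.exists_quadMinorant (hΦ : ProperFun P.Φ) {X Y U V : Mat n r} {σ : ℝ}
    (h : P.UpdateY S X Y U σ V) :
    ∃ e, QuadMinorant P.Φ (|S.α| * ‖mulTBilin n r U‖ ^ 2 * colConst n r + |P.lam| + |σ|) V e ∧
      NearGradient S.α P.lam σ (mulTBilin n r U) (P.Zof S X Y) Y U V e := by
  rcases h with h | h | ⟨φ, -, hsum, h⟩
  · rw [ProxY] at h
    simp only [norm_sub_rev U] at h
    exact exists_quadMinorant_of_prox hΦ h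
  · rw [ProxLinY] at h
    simp only [norm_sub_rev U] at h
    exact exists_quadMinorant_of_proxLinear hΦ h
  · simp only [norm_sub_rev (col U _)] at h
    exact exists_quadMinorant_of_hierarchical hΦ hsum h

theorem norm_residual_sub_le {m d : ℝ} {X Y U V : Mat n r} (hU : ‖U‖ ≤ m) (hY : ‖Y‖ ≤ m)
    (hUX : ‖U - X‖ ≤ d) (hVY : ‖V - Y‖ ≤ d) :
    ‖P.residual U V - P.residual X Y‖ ≤ ‖P.A‖ ^ 2 * (2 * ‖mulTBilin n r‖ * m) * d := by
  have hm : 0 ≤ m := (norm_nonneg _).trans hU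
  have hd : 0 ≤ d := (norm_nonneg _).trans hUX
  have h1 : P.residual U V - P.residual X Y =
      ContinuousLinearMap.adjoint P.A (P.A (mulT U (V - Y) + mulT (U - X) Y)) := by
    rw [← mulT_sub_mulT, residual, residual, ← map_sub, map_sub P.A, sub_sub_sub_cancel_right]
  rw [h1]
  refine (norm_adjoint_map_le P.A _).trans ?_
  have h2 : ‖mulT U (V - Y) + mulT (U - X) Y‖ ≤ 2 * ‖mulTBilin n r‖ * m * d := by
    refine (norm_add_le _ _).trans ?_
    have h3 : ‖mulT U (V - Y)‖ ≤ ‖mulTBilin n r‖ * m * d :=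
      (norm_mulT_le _ _).trans (by gcongr)
    have h4 : ‖mulT (U - X) Y‖ ≤ ‖mulTBilin n r‖ * d * m :=
      (norm_mulT_le _ _).trans (by gcongr)
    linarith
  rw [mul_assoc]
  gcongr

theorem norm_residual_le {m : ℝ} {U V : Mat n r} (hU : ‖U‖ ≤ m) (hV : ‖V‖ ≤ m) :
    ‖P.residual U V‖ ≤ ‖P.A‖ * (‖P.A‖ * (‖mulTBilin n r‖ * m * m) + ‖P.b‖) := by
  have hm : 0 ≤ m := (norm_nonneg _).trans hU
  refine (ContinuousLinearMap.le_opNorm _ _).trans ?_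
  rw [LinearIsometryEquiv.norm_map]
  gcongr
  refine (norm_sub_le _ _).trans ?_
  gcongr
  refine (P.A.le_opNorm _).trans ?_
  gcongr
  exact (norm_mulT_le _ _).trans (by gcongr)

/-- A step of the algorithm inside a bounded set yields a subgradient of the objective at the new
point, of size proportional to the length of the step, with a uniform quadratic error. -/
theorem exists_isMinorant_of_updates (hS : P.Admissible S) (hΨ : ProperFun P.Ψ)
    (hΦ : ProperFun P.Φ) (m B : ℝ) :
    ∃ C K : ℝ, ∀ (X Y U V : Mat n r) (μ σ a : ℝ), ‖Y‖ ≤ m → ‖U‖ ≤ m → ‖V‖ ≤ m →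
      |μ| ≤ B → |σ| ≤ B → P.UpdateX S X Y μ U → P.UpdateY S X Y U σ V → P.F U V = a →
      ∃ D : MatPair n r, ‖D‖ ≤ C * ‖(WithLp.toLp 2 (U, V) : MatPair n r) - WithLp.toLp 2 (X, Y)‖ ∧
        IsMinorant P.objective P.smooth K a (WithLp.toLp 2 (U, V)) D := by
  set β : ℝ := ‖mulTBilin n r‖ with hβ
  set cq : ℝ := ‖P.A‖ * (‖P.A‖ * (β * m * m) + ‖P.b‖) with hcq
  set cl : ℝ := ‖P.A‖ ^ 2 * (2 * β * m) with hcl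
  set K : ℝ := |S.α| * (β * m) ^ 2 * colConst n r with hK
  refine ⟨(β * cq + β * m * cl + |P.lam| + (K + B)) + (β * m * (cl + |S.α| * (β * m)) + (K + B)),
    K + |P.lam| + B, fun X Y U V μ σ a hY hU hV hμ hσ hX' hY' ha => ?_⟩
  have hm : 0 ≤ m := (norm_nonneg _).trans hU
  have hc0 : 0 ≤ colConst n r := zero_le_one.trans one_le_colConst
  have hLY : ‖(mulTBilin n r).flip Y‖ ≤ β * m := (norm_mulTBilin_flip_le Y).trans (by gcongr)
  have hLU : ‖mulTBilin n r U‖ ≤ β * m := (norm_mulTBilin_apply_le U).trans (by gcongr)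
  obtain ⟨e₁, hq₁, hn₁⟩ := hX'.exists_quadMinorant hΨ
  obtain ⟨e₂, hq₂, hn₂⟩ := hY'.exists_quadMinorant hΦ
  have hKL : ∀ {L : Mat n r →L[ℝ] Mat n n}, ‖L‖ ≤ β * m →
      |S.α| * ‖L‖ ^ 2 * colConst n r ≤ K := by
    intro L hL
    rw [hK]
    gcongr
  have hmin := isMinorant_objective
    (hq₁.mono (add_le_add (add_le_add (hKL hLY) (le_refl |P.lam|)) hμ))
    (hq₂.mono (add_le_add (add_le_add (hKL hLU) (le_refl |P.lam|)) hσ)) ha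
  refine ⟨_, ?_, hmin⟩
  set d : ℝ := ‖(WithLp.toLp 2 (U, V) : MatPair n r) - WithLp.toLp 2 (X, Y)‖ with hd
  have hUX : ‖U - X‖ ≤ d := 
    WithLp.norm_fst_le (x := (WithLp.toLp 2 (U, V) : MatPair n r) - WithLp.toLp 2 (X, Y))
  have hVY : ‖V - Y‖ ≤ d := 
    WithLp.norm_snd_le (x := (WithLp.toLp 2 (U, V) : MatPair n r) - WithLp.toLp 2 (X, Y))
  have hd0 : 0 ≤ d := norm_nonneg _
  have hres : ‖P.residual U V - P.residual X Y‖ ≤ cl * d := norm_residual_sub_le hU hY hUX hVY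
  have hresU : ‖P.residual U V‖ ≤ cq := norm_residual_le hU hV
  have hstep : ∀ {L : Mat n r →L[ℝ] Mat n n} {ν : ℝ} {s : ℝ}, ‖L‖ ≤ β * m → |ν| ≤ B → s ≤ d →
      0 ≤ s → (|S.α| * ‖L‖ ^ 2 * colConst n r + |ν|) * s ≤ (K + B) * d := by
    intro L ν s hL hν hs hs0
    have hB : 0 ≤ B := (abs_nonneg ν).trans hν
    have hK0 : 0 ≤ K := by positivity
    exact mul_le_mul (add_le_add (hKL hL) hν) hs hs0 (by positivity)
  -- Since e₁ is close to the data gradient at (X, Y) plus λ (U - Y), three errors remain: the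
  -- variation of the data gradient, the replacement of Y by V in the penalty, and the update error.
  have hg₁ : ‖ContinuousLinearMap.adjoint ((mulTBilin n r).flip V) (P.residual U V) +
      P.lam • (U - V) - e₁‖ ≤ (β * cq + β * m * cl + |P.lam| + (K + B)) * d := by
    have h1 : ‖ContinuousLinearMap.adjoint ((mulTBilin n r).flip V) (P.residual U V) -
        ContinuousLinearMap.adjoint ((mulTBilin n r).flip Y) (P.residual X Y)‖ ≤
        (β * cq + β * m * cl) * d := by
      refine (adjoint_sub_adjoint_norm_le _ _ _ _).trans ?_
      rw [← map_sub]
      have h2 : ‖(mulTBilin n r).flip (V - Y)‖ ≤ β * d :=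
        (norm_mulTBilin_flip_le _).trans (by gcongr)
      calc _ ≤ β * d * cq + β * m * (cl * d) := by gcongr
        _ = _ := by ring
    have h3 : S.α • ContinuousLinearMap.adjoint ((mulTBilin n r).flip Y)
        ((mulTBilin n r).flip Y X - P.Zof S X Y) =
        ContinuousLinearMap.adjoint ((mulTBilin n r).flip Y) (P.residual X Y) := by
      rw [← map_smul, ContinuousLinearMap.flip_apply, mulTBilin_apply, hS.smul_sub_Zof]
    rw [NearGradient, h3] at hn₁
    have h4 := hn₁.trans (hstep hLY hμ hUX (norm_nonneg _))
    have h5 : ‖P.lam • (Y - V)‖ ≤ |P.lam| * d := by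
      rw [norm_smul, Real.norm_eq_abs, norm_sub_rev]
      gcongr
    have h6 : ContinuousLinearMap.adjoint ((mulTBilin n r).flip V) (P.residual U V) +
        P.lam • (U - V) - e₁ =
        (ContinuousLinearMap.adjoint ((mulTBilin n r).flip V) (P.residual U V) -
          ContinuousLinearMap.adjoint ((mulTBilin n r).flip Y) (P.residual X Y)) +
        P.lam • (Y - V) - (e₁ - (ContinuousLinearMap.adjoint ((mulTBilin n r).flip Y)
          (P.residual X Y) + P.lam • (U - Y))) := by
      simp only [smul_sub]
      abel
    rw [h6]
    refine (norm_sub_le _ _).trans ((add_le_add ((norm_add_le _ _).trans (add_le_add h1 h5))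
      h4).trans (le_of_eq ?_))
    ring
  have hg₂ : ‖ContinuousLinearMap.adjoint (mulTBilin n r U) (P.residual U V) +
      P.lam • (V - U) - e₂‖ ≤ (β * m * (cl + |S.α| * (β * m)) + (K + B)) * d := by
    -- Z was formed from X but the second update uses U; the mismatch is α (U - X) Yᵀ, of the order
    -- of the step.
    have h3 : S.α • ContinuousLinearMap.adjoint (mulTBilin n r U)
        (mulTBilin n r U Y - P.Zof S X Y) =
        ContinuousLinearMap.adjoint (mulTBilin n r U)
          (P.residual X Y + S.α • mulT (U - X) Y) := by
      rw [← map_smul, ← hS.smul_sub_Zof, ← smul_add]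
      congr 2
      simp only [← mulTBilin_apply, map_sub, sub_apply]
      abel
    rw [NearGradient, h3] at hn₂
    have h4 := hn₂.trans (hstep hLU hσ hVY (norm_nonneg _))
    have h5 : ‖ContinuousLinearMap.adjoint (mulTBilin n r U)
        (P.residual U V - P.residual X Y - S.α • mulT (U - X) Y)‖ ≤
        β * m * (cl + |S.α| * (β * m)) * d := by
      refine (ContinuousLinearMap.le_opNorm _ _).trans ?_
      rw [LinearIsometryEquiv.norm_map]
      have h6 : ‖S.α • mulT (U - X) Y‖ ≤ |S.α| * (β * d * m) := by
        rw [norm_smul, Real.norm_eq_abs]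
        gcongr
        exact (norm_mulT_le _ _).trans (by gcongr)
      calc _ ≤ β * m * (cl * d + |S.α| * (β * d * m)) := by
            gcongr
            exact (norm_sub_le _ _).trans (add_le_add hres h6)
        _ = _ := by ring
    have h7 : ContinuousLinearMap.adjoint (mulTBilin n r U) (P.residual U V) +
        P.lam • (V - U) - e₂ = ContinuousLinearMap.adjoint (mulTBilin n r U)
          (P.residual U V - P.residual X Y - S.α • mulT (U - X) Y) -
        (e₂ - (ContinuousLinearMap.adjoint (mulTBilin n r U)
          (P.residual X Y + S.α • mulT (U - X) Y) + P.lam • (V - U))) := by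
      simp only [map_sub, map_add]
      abel
    rw [h7]
    refine (norm_sub_le _ _).trans ((add_le_add h5 h4).trans (le_of_eq ?_))
    ring
  have hnorm : ∀ a b : Mat n r, ‖WithLp.toLp 2 (a, b)‖ ≤ ‖a‖ + ‖b‖ := by
    intro a b
    refine (sq_le_sq₀ (norm_nonneg _) (by positivity)).1 ?_
    rw [WithLp.prod_norm_sq_eq_of_L2]
    change ‖a‖ ^ 2 + ‖b‖ ^ 2 ≤ _
    have := mul_nonneg (norm_nonneg a) (norm_nonneg b)
    nlinarith
  refine (hnorm _ _).trans ((add_le_add hg₁ hg₂).trans (le_of_eq ?_))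
  ring

end Updates

end GSMF
end

/-! ### The infinite run and the conclusion -/

namespace GSMF

variable {n r q : ℕ} {P : GSMF n r q} {S : ANAUMParams}

/-- Real values, step lengths and weights of a run, with the averaging recursion and the sufficient
decrease. -/
theorem IsANAUMRun.exists_values {X Y : ℕ → Mat n r} {R : ℕ → ℝ} (hrun : P.IsANAUMRun S X Y R)
    (hΨ : ProperFun P.Ψ) (hΦ : ProperFun P.Φ) :
    ∃ f p : ℕ → ℝ, (∀ k, P.F (X k) (Y k) = f k) ∧ (∀ k, S.pmin ≤ p k) ∧ (∀ k, p k ≤ 1) ∧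
      f 0 = R 0 ∧ (∀ k, R (k + 1) = (1 - p k) * R k + p k * f (k + 1)) ∧
      ∀ k, f (k + 1) ≤ R k - S.c / 2 *
        ‖(WithLp.toLp 2 (X (k + 1), Y (k + 1)) : MatPair n r) - WithLp.toLp 2 (X k, Y k)‖ ^ 2 := by
  choose μ₀ σ₀ μ σ p _ _ _ _ hls hp hp1 hR using hrun.step
  have htop : ∀ k, P.F (X k) (Y k) ≠ ⊤ := by
    rintro (_ | k)
    · rw [← hrun.start]
      exact EReal.coe_ne_top _
    · exact ne_top_of_le_ne_top (EReal.coe_ne_top _) (hls k)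
  have hf : ∀ k, P.F (X k) (Y k) = ((P.F (X k) (Y k)).toReal : EReal) := fun k =>
    (EReal.coe_toReal (htop k) (objective_ne_bot hΨ hΦ _)).symm
  refine ⟨fun k => (P.F (X k) (Y k)).toReal, p, hf, hp, hp1, ?_, fun k => ?_, fun k => ?_⟩
  · simp [← hrun.start]
  · have h := hR k
    rw [hf (k + 1), ← EReal.coe_mul, ← EReal.coe_add, EReal.coe_eq_coe_iff] at h
    exact h
  · have h := hls k
    rw [LineSearch, hf (k + 1), EReal.coe_le_coe_iff] at h
    rw [WithLp.prod_norm_sq_eq_of_L2]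
    exact h

end GSMF

theorem theorem5p3 {n r q : ℕ} (P : GSMF n r q) (S : ANAUMParams)
    (hΨ : ProperClosedBddBelow P.Ψ) (hΦ : ProperClosedBddBelow P.Φ)
    (hA : P.A ∘L ContinuousLinearMap.adjoint P.A =
      ContinuousLinearMap.id ℝ (EuclideanSpace ℝ (Fin q)))
    (hlam : 0 ≤ P.lam)
    (hlevel : LevelBounded P.objective)
    (hS : P.Admissible S)
    (θ : ℝ) (hθ0 : 0 ≤ θ) (hθ1 : θ < 1)
    (hKL : IsKLWithExponent P.objective θ)
    (X Y : ℕ → Mat n r) (R : ℕ → ℝ) (hrun : P.IsANAUMRun S X Y R) :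
    ∃ (f : ℕ → ℝ) (ζ : ℝ),
      (∀ k, (f k : EReal) = P.F (X k) (Y k)) ∧
      Tendsto R atTop (𝓝 ζ) ∧
      Tendsto f atTop (𝓝 ζ) ∧
      (θ = 0 → ∃ c₁ η₁ : ℝ, 0 < c₁ ∧ 0 < η₁ ∧ η₁ < 1 ∧
        ∀ᶠ k in atTop, ζ - c₁ * η₁ ^ k ≤ f k ∧ f k ≤ ζ) ∧
      (0 < θ → θ ≤ 1 / 2 → ∃ c₂ η₂ : ℝ, 0 < c₂ ∧ 0 < η₂ ∧ η₂ < 1 ∧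
        ∀ᶠ k in atTop, |f k - ζ| ≤ c₂ * η₂ ^ k) ∧
      (1 / 2 < θ → ∃ c₃ : ℝ, 0 < c₃ ∧
        ∀ᶠ k : ℕ in atTop, |f k - ζ| ≤ c₃ * (k : ℝ) ^ (-(1 / (2 * θ - 1)))) := by
  obtain ⟨f, p, hfF, hp, hp1, hf0, hR, hdesc⟩ := hrun.exists_values hΨ.1 hΦ.1
  set W : ℕ → MatPair n r := fun k => WithLp.toLp 2 (X k, Y k) with hW
  set d : ℕ → ℝ := fun k => ‖W (k + 1) - W k‖ with hd
  have hc := hS.c_pos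
  have hpmin := hS.pmin_pos
  have hpmin1 := hS.pmin_lt
  replace hdesc : ∀ k, f (k + 1) ≤ R k - S.c / 2 * d k ^ 2 := hdesc
  have hanti : Antitone R := averaged_antitone hc hpmin hp hR hdesc
  -- As p ≤ 1, R (k+1) is a convex combination of f (k+1) and of R k ≥ f (k+1). All iterates thus
  -- stay in the level set of R 0, which is bounded.
  have hfR : ∀ k, f k ≤ R k := by
    rintro (_ | k)
    · exact hf0.le
    · have h1 : f (k + 1) ≤ R k := (hdesc k).trans (sub_le_self _ (by positivity))
      rw [hR k]
      nlinarith [hp1 k]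
  obtain ⟨b, hb⟩ := GSMF.bddBelowFun_objective hlam hΨ.2.2 hΦ.2.2
  have hbf : ∀ k, b ≤ f k := fun k => by
    have h := hb (W k)
    rwa [show P.objective (W k) = f k from hfF k, EReal.coe_le_coe_iff] at h
  have hlim : Tendsto R atTop (𝓝 (⨅ k, R k)) := tendsto_atTop_ciInf hanti
    ⟨b, by rintro _ ⟨k, rfl⟩; exact (hbf k).trans (hfR k)⟩
  set ζ : ℝ := ⨅ k, R k
  have hflim := tendsto_values_of_averaged hc hpmin hpmin1 hp hR hdesc hlim
  have hdlim := tendsto_steps_of_averaged hc hpmin hpmin1 hp hR hdesc hlim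
  have hWlev : ∀ k, W k ∈ {x | P.objective x ≤ (R 0 : EReal)} := fun k => by
    rw [Set.mem_ofPred_eq, show P.objective (W k) = f k from hfF k, EReal.coe_le_coe_iff]
    exact (hfR k).trans (hanti (Nat.zero_le k))
  obtain ⟨m, hm⟩ := (hlevel (R 0)).exists_norm_le
  have hXm : ∀ k, ‖X k‖ ≤ m := fun k =>
    (WithLp.norm_fst_le (x := W k)).trans (hm _ (hWlev k))
  have hYm : ∀ k, ‖Y k‖ ≤ m := fun k =>
    (WithLp.norm_snd_le (x := W k)).trans (hm _ (hWlev k))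
  obtain ⟨B, hB⟩ := GSMF.exists_parameter_bound (r := r) hS (hS.cap_pos hA) m
  obtain ⟨C, K, hCK⟩ := GSMF.exists_isMinorant_of_updates (P := P) hS hΨ.1 hΦ.1 m B
  -- The index shift matters: the step of length d k yields a subgradient at its endpoint W (k + 1),
  -- which is where KL is later applied.
  have hD : ∀ k, ∃ D : MatPair n r, ‖D‖ ≤ C * d k ∧
      IsMinorant P.objective P.smooth K (f (k + 1)) (W (k + 1)) D := by
    intro k
    obtain ⟨μ₀, σ₀, μ, σ, _, h1, h2, h3, hT, -⟩ := hrun.step k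
    obtain ⟨hU, hV, hμ, hσ⟩ := hB _ _ _ _ _ _ _ _ _ (hYm k) (hXm (k + 1)) h1 h2 h3 hT
    exact hCK _ _ _ _ _ _ _ (hYm k) (hXm (k + 1)) (hYm (k + 1)) hμ hσ hU hV (hfF (k + 1))
  choose D hDn hDm using hD
  obtain ⟨M, hM⟩ := eventually_rpow_le_of_isKLWithExponent (w := fun k => W (k + 1))
    (GSMF.lowerSemicontinuous_objective hΨ hΦ) P.contDiff_smooth hθ1 hKL
    (fun k => hfF (k + 1)) hDm hDn hdlim ((tendsto_add_atTop_iff_nat 1).2 hflim)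
    ((hlevel (R 0)).subset (by rintro _ ⟨k, rfl⟩; exact hWlev (k + 1)))
  refine ⟨f, ζ, fun k => (hfF k).symm, hlim, hflim, fun hθ => ?_, fun _ hθ => ?_, fun hθ => ?_⟩
  · refine finite_identification_rate hc hpmin hpmin1 hp hR hdesc hlim (M := M) ?_
    filter_upwards [hM] with k hk hlt
    simpa [hθ] using hk hlt
  · exact linear_rate hc hpmin hpmin1 hp hR hdesc hlim hM hθ
  · exact sublinear_rate hc hpmin hpmin1 hp hR hdesc hlim hM hθ hθ1
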